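/- For an integer polynomial $p$ let $H(p)$ be its height (the maximum of the absolute values of its coefficients) and $D(p)$ its discriminant, so that $D(p)=b^2-4ac$ for $p(x)=ax^2+bx+c$. For real $Q>1$ and $D\ge 1$ let $N(Q,D)$ be the number of polynomials $p\in\mathbb{Z}[x]$ with $\deg p=2$, $H(p)\le Q$ and $|D(p)|\le D$. For $0<v<\tfrac34$ let \[ \mathcal{P}_2(Q,v)=\{p\in\mathbb{Z}[x] : \deg p=2,\ H(p)\le Q,\ |D(p)|\le \gamma_2\, Q^{2-2v}\},\qquad \gamma_2=\sup_{p\in\mathbb{Z}[x],\ \deg p=2}\frac{|D(p)|}{H(p)^{2}}=5 . \] Then the following hold. (1) For all real $Q>1$ and $D$ with $1\le D\le Q^2/2$, \[ N(Q,D)=\kappa QD+O\bigl(D^{3/2}\ln Q+(Q\ln Q)^{3/2}\bigr),\qquad \kappa=4(\ln 2+1), \] where the implied constant is absolute. (2) For every fixed $v$ with $0<v<\tfrac34$ there are constants $c_1,c_2>0$, depending only on $v$, such that for all real $Q>1$ \[ c_1Q^{3-2v}\le \#\mathcal{P}_2(Q,v)\le c_2Q^{3-2v}. \] -/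

import Mathlib

open Polynomial

/-- The height of an integer polynomial: the largest absolute value of its coefficients. -/
def polyHeight (p : ℤ[X]) : ℕ :=
  p.support.sup fun i => (p.coeff i).natAbs

/-- The integer polynomials of degree `n` and height at most `Q`. -/
def polysOfHeightLE (n : ℕ) (Q : ℝ) : Set ℤ[X] :=
  {p | p.degree = n ∧ (polyHeight p : ℝ) ≤ Q}

/-- `γ_n`, the supremum of `|D(p)| / H(p) ^ (2n - 2)` over the integer polynomials `p` of
degree `n`. -/
noncomputable def discrGamma (n : ℕ) : ℝ :=
  sSup {t : ℝ | ∃ p : ℤ[X], p.degree = n ∧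
    t = |(p.discr : ℝ)| / (polyHeight p : ℝ) ^ (2 * n - 2)}

/-- `P_n(Q, v)`: the integer polynomials of degree `n` and height at most `Q` whose discriminant
is at most `γ_n Q ^ (2n - 2 - 2v)` in absolute value. -/
def polysOfSmallDiscr (n : ℕ) (Q v : ℝ) : Set ℤ[X] :=
  {p | p ∈ polysOfHeightLE n Q ∧
    |(p.discr : ℝ)| ≤ discrGamma n * Q ^ (2 * (n : ℝ) - 2 - 2 * v)}

/-- `N(Q, D)`: the number of integer polynomials of degree `2` and height at most `Q` whose
discriminant is at most `D` in absolute value. -/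
noncomputable def quadCount (Q D : ℝ) : ℕ :=
  {p : ℤ[X] | p ∈ polysOfHeightLE 2 Q ∧ |(p.discr : ℝ)| ≤ D}.ncard

/-! Let R = ⌊Q⌋ and M = ⌊D⌋. For a leading coefficient a ≥ 1 (negative ones contribute the same,
through c ↦ -c), the substitution d = b² - 4ac turns the pairs (b, c) into pairs (b, d) with b² ≡ d
mod 4a, |b| ≤ R, |d| ≤ M and |b² - d| ≤ 4aR. The last condition differs from b² ≤ 4aR only where |b²
- 4aR| ≤ M. There are O(√M) such b, each with at most M/a + 1 values of d, so over all a ≤ R this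
costs O(M^{3/2} log 4R + R√M) (`abs_card_quadPairs_sub_le`, `card_boundaryPairs_le`).

What remains is a box |b| ≤ β, |d| ≤ M with β = ⌊min(R, 2√(aR))⌋. Equidistribution modulo 4a
predicts (2β+1)(2M+1)/(4a) solutions, about M · min(R/a, 2√(R/a)). Comparing the sum over a ≤ R with
an integral gives 2R(ln 2 + 1)M, and the two signs of a double this to κRM.

The deviation from equidistribution is expanded in additive characters modulo 4a. The sum over d is
geometric and yields a weight 1/(2|h|) at the frequency h. Weyl differencing bounds the quadratic
sum over b by a constant times R√(gcd(h, 2a)/a) + √(R log 4R) (`norm_quadratic_sum_le`). A single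
gcd may be large, but its average over a and h is harmless (`exists_sum_sqrt_gcd_le`), so the total
is O((R log 4R)^{3/2}).

For the second claim take D = 5Q^{2-2v}. The main term has order Q^{3-2v}, and the errors Q^{3-3v}
log Q and (Q log Q)^{3/2} are of smaller order because v > 0 and v < 3/4 respectively. Bounded Q are
handled by trivial counts. -/

/-! ### Geometric sums of additive characters and Weyl differencing -/

-- Jordan's inequality sin x ≥ 2x/π, applied to |e(t) - 1| = 2|sin πt| with |t| ≤ 1/2.
open ZMod in
theorem four_mul_abs_valMinAbs_div_le {q : ℕ} [NeZero q] (r : ZMod q) :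
    4 * |(r.valMinAbs : ℝ)| / q ≤ ‖stdAddChar r - 1‖ := by
  have hq : (0 : ℝ) < q := by exact_mod_cast NeZero.pos q
  have h1 : stdAddChar r = Complex.exp (Complex.I * ((2 * Real.pi * r.valMinAbs / q : ℝ) : ℂ)) := by
    conv_lhs => rw [← coe_valMinAbs r]
    rw [stdAddChar_coe]
    congr 1
    push_cast
    ring
  rw [h1, Complex.norm_exp_I_mul_ofReal_sub_one, norm_mul, Real.norm_eq_abs, Real.norm_eq_abs]
  have hm := valMinAbs_mem_Ioc r
  have hm' : |(r.valMinAbs : ℝ)| ≤ q / 2 := by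
    have h1 : (-(q : ℝ)) < r.valMinAbs * 2 := by exact_mod_cast hm.1
    have h2 : (r.valMinAbs * 2 : ℝ) ≤ q := by exact_mod_cast hm.2
    rw [abs_le]; constructor <;> linarith
  have habs : |2 * Real.pi * r.valMinAbs / q / 2| = Real.pi * |(r.valMinAbs : ℝ)| / q := by
    rw [show 2 * Real.pi * r.valMinAbs / q / 2 = Real.pi * r.valMinAbs / q by ring,
      abs_div, abs_mul, abs_of_pos Real.pi_pos, abs_of_pos hq]
  have h3 := Real.mul_abs_le_abs_sin (x := 2 * Real.pi * r.valMinAbs / q / 2) (by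
    rw [habs, div_le_div_iff₀ hq two_pos]
    nlinarith [Real.pi_pos])
  rw [habs] at h3
  have h4 : 2 / Real.pi * (Real.pi * |(r.valMinAbs : ℝ)| / q) = 2 * |(r.valMinAbs : ℝ)| / q := by
    field_simp
  rw [h4] at h3
  calc 4 * |(r.valMinAbs : ℝ)| / q = 2 * (2 * |(r.valMinAbs : ℝ)| / q) := by ring
    _ ≤ _ := by rw [abs_of_pos (two_pos : (0 : ℝ) < 2)]; gcongr

theorem sum_Ico_int_sub {G : Type*} [AddCommGroup G] (f : ℤ → G) {x y : ℤ} (hxy : x ≤ y) :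
    ∑ b ∈ Finset.Ico x y, (f (b + 1) - f b) = f y - f x := by
  induction y, hxy using Int.leInduction with
  | base => simp
  | succ n hn ih =>
    rw [← Finset.insert_Ico_right_eq_Ico_add_one hn, Finset.sum_insert (by simp), ih]
    abel

/-- The bound for a sum of at most `N` consecutive terms of the geometric progression attached to
the residue `r` modulo `q`. -/
noncomputable def geomBound (q : ℕ) (N : ℝ) (r : ZMod q) : ℝ :=
  if r = 0 then N else q / (2 * |(r.valMinAbs : ℝ)|)

theorem geomBound_nonneg {q : ℕ} {N : ℝ} (hN : 0 ≤ N) (r : ZMod q) : 0 ≤ geomBound q N r := by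
  unfold geomBound
  split_ifs <;> positivity

-- Multiplying by `stdAddChar r - 1` telescopes the sum to a difference of two unimodular numbers,
-- of norm at most 2; the previous bound divides out the factor.
open ZMod in
theorem norm_sum_stdAddChar_mul_le {q : ℕ} [NeZero q] (r : ZMod q) (x y : ℤ) (N : ℝ)
    (hN : 0 ≤ N) (hxy : (y - x : ℝ) ≤ N) :
    ‖∑ b ∈ Finset.Ico x y, stdAddChar (r * (b : ZMod q))‖ ≤ geomBound q N r := by
  have hq : (0 : ℝ) < q := by exact_mod_cast NeZero.pos q
  rcases lt_or_ge y x with h | h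
  · rw [Finset.Ico_eq_empty (by simpa using h.le)]
    simpa using geomBound_nonneg hN r
  unfold geomBound
  split_ifs with hr
  · subst hr
    simp only [zero_mul, AddChar.map_zero_eq_one, Finset.sum_const, Int.card_Ico, nsmul_eq_mul,
      mul_one, Complex.norm_natCast]
    refine le_trans ?_ hxy
    have : (((y - x).toNat : ℤ) : ℝ) = ((y - x : ℤ) : ℝ) := by rw [Int.toNat_of_nonneg (by omega)]
    push_cast at this
    exact this.le
  · have hm : 0 < |(r.valMinAbs : ℝ)| := by
      simpa using hr
    have htel : (stdAddChar r - 1) * ∑ b ∈ Finset.Ico x y, stdAddChar (r * (b : ZMod q)) =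
        stdAddChar (r * (y : ZMod q)) - stdAddChar (r * (x : ZMod q)) := by
      rw [← sum_Ico_int_sub (fun b : ℤ => stdAddChar (r * (b : ZMod q))) h, Finset.mul_sum]
      refine Finset.sum_congr rfl fun b _ => ?_
      push_cast
      rw [mul_add, mul_one, AddChar.map_add_eq_mul]
      ring
    have h2 : ‖stdAddChar (r * (y : ZMod q)) - stdAddChar (r * (x : ZMod q))‖ ≤ 2 := by
      refine (norm_sub_le _ _).trans ?_
      simp only [stdAddChar_apply, Circle.norm_coe]
      norm_num
    rw [← htel, norm_mul] at h2
    have h3 := (mul_le_mul_of_nonneg_right (four_mul_abs_valMinAbs_div_le r)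
      (norm_nonneg (∑ b ∈ Finset.Ico x y, stdAddChar (r * (b : ZMod q))))).trans h2
    rw [le_div_iff₀ (by positivity)]
    rw [div_mul_eq_mul_div, div_le_iff₀ hq] at h3
    linarith

open ZMod in
/-- Weyl differencing for quadratic exponential sums. -/
theorem norm_sq_sum_stdAddChar_sq_le {q : ℕ} [NeZero q] (h : ZMod q) (x : ℤ) (N : ℕ) :
    ‖∑ b ∈ Finset.Ico x (x + N), stdAddChar (h * (b : ZMod q) ^ 2)‖ ^ 2 ≤
      ∑ k ∈ Finset.Ico (-N : ℤ) N, geomBound q N (2 * h * (k : ZMod q)) := by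
  set I := Finset.Ico x (x + N) with hI
  have hconj : ∀ r : ZMod q, (starRingEnd ℂ) (stdAddChar r) = stdAddChar (-r) := by
    intro r
    rw [AddChar.map_neg_eq_conj]
  -- Expand |S|² as a double sum over b, b' and set k = b' - b: the quadratic terms in b cancel,
  -- leaving a phase linear in b for each k.
  have h1 : ((‖∑ b ∈ I, stdAddChar (h * (b : ZMod q) ^ 2)‖ ^ 2 : ℝ) : ℂ) =
      ∑ k ∈ Finset.Ico (-N : ℤ) N, ∑ b ∈ I with b + k ∈ I,
        stdAddChar (h * (k : ZMod q) ^ 2) * stdAddChar (2 * h * (k : ZMod q) * (b : ZMod q)) := by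
    rw [Complex.ofReal_pow, ← Complex.mul_conj', map_sum, Finset.sum_mul_sum, Finset.sum_comm]
    simp_rw [Finset.sum_filter]
    rw [Finset.sum_comm (s := Finset.Ico (-N : ℤ) N)]
    refine Finset.sum_congr rfl fun b hb => ?_
    rw [← Finset.sum_filter]
    refine Finset.sum_nbij' (fun b' => b' - b) (fun k => b + k) ?_ ?_ ?_ ?_ ?_
    · intro b' hb'
      simp only [hI, Finset.mem_Ico, Finset.mem_filter] at *
      omega
    · intro k hk
      simp only [Finset.mem_filter] at hk
      exact hk.2
    · intro b' _; ring
    · intro k _; ring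
    · intro b' _
      rw [hconj, ← AddChar.map_add_eq_mul, ← AddChar.map_add_eq_mul]
      congr 1
      push_cast
      ring
  have h2 : ‖∑ b ∈ I, stdAddChar (h * (b : ZMod q) ^ 2)‖ ^ 2 =
      ‖((‖∑ b ∈ I, stdAddChar (h * (b : ZMod q) ^ 2)‖ ^ 2 : ℝ) : ℂ)‖ := by
    rw [Complex.norm_real, Real.norm_of_nonneg (by positivity)]
  rw [h2, h1]
  refine (norm_sum_le _ _).trans (Finset.sum_le_sum fun k _ => ?_)
  rw [← Finset.mul_sum, norm_mul, stdAddChar_apply, Circle.norm_coe, one_mul]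
  -- For fixed k the admissible b form an interval of length at most N, so the inner sum is
  -- geometric.
  have h3 : (I.filter fun b => b + k ∈ I) = Finset.Ico (max x (x - k)) (min (x + N) (x + N - k)) := by
    ext b
    simp only [hI, Finset.mem_Ico, Finset.mem_filter]
    omega
  rw [h3]
  refine norm_sum_stdAddChar_mul_le _ _ _ _ (Nat.cast_nonneg N) ?_
  have : min (x + N) (x + N - k) - max x (x - k) ≤ (N : ℤ) := by omega
  exact_mod_cast this

/-! ### Sums over residues and over multiples -/

/-- Only the two residues ±j have a minimal representative of absolute value j. -/
theorem sum_zmod_ne_zero_le {q : ℕ} [NeZero q] (F : ℕ → ℝ) (hF : ∀ j, 0 ≤ F j) :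
    ∑ h : ZMod q with h ≠ 0, F h.valMinAbs.natAbs ≤ 2 * ∑ j ∈ Finset.Icc 1 (q / 2), F j := by
  classical
  have hmap : ∀ h ∈ (Finset.univ.filter fun h : ZMod q => h ≠ 0),
      h.valMinAbs.natAbs ∈ Finset.Icc 1 (q / 2) := by
    intro h hh
    simp only [Finset.mem_filter, Finset.mem_univ, true_and] at hh
    rw [Finset.mem_Icc]
    refine ⟨?_, ZMod.natAbs_valMinAbs_le h⟩
    rw [Nat.one_le_iff_ne_zero, Int.natAbs_ne_zero]
    simpa using hh
  rw [← Finset.sum_fiberwise_of_maps_to hmap, Finset.mul_sum]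
  refine Finset.sum_le_sum fun j _ => ?_
  have hcard : ((Finset.univ.filter fun h : ZMod q => h ≠ 0).filter
      fun h => h.valMinAbs.natAbs = j).card ≤ 2 := by
    refine (Finset.card_le_card (t := {(j : ZMod q), -(j : ZMod q)}) ?_).trans Finset.card_le_two
    intro h hh
    simp only [Finset.mem_filter] at hh
    simp only [Finset.mem_insert, Finset.mem_singleton]
    rcases Int.natAbs_eq h.valMinAbs with h' | h'
    · left; rw [← ZMod.coe_valMinAbs h, h', hh.2]; simp
    · right; rw [← ZMod.coe_valMinAbs h, h', hh.2]; simp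
  calc _ = ∑ h ∈ ((Finset.univ.filter fun h : ZMod q => h ≠ 0).filter
      (fun h => h.valMinAbs.natAbs = j)), (F j : ℝ) := by
        refine Finset.sum_congr rfl fun h hh => ?_
        simp only [Finset.mem_filter] at hh
        rw [hh.2]
    _ ≤ 2 * F j := by
      rw [Finset.sum_const, nsmul_eq_mul]
      have : (((Finset.univ.filter fun h : ZMod q => h ≠ 0).filter
        fun h => h.valMinAbs.natAbs = j).card : ℝ) ≤ 2 := by exact_mod_cast hcard
      exact mul_le_mul_of_nonneg_right this (hF j)

theorem sum_inv_Icc_le (n : ℕ) : ∑ j ∈ Finset.Icc 1 n, (1 / j : ℝ) ≤ 1 + Real.log n := by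
  have := harmonic_le_one_add_log n
  rw [harmonic_eq_sum_Icc] at this
  push_cast at this
  simpa [one_div] using this

/-- The multiples of `d` among `1, …, n`. -/
theorem sum_dvd_Icc_le (f : ℕ → ℝ) (hf : ∀ j, 0 ≤ f j) (d n : ℕ) (hd : 0 < d) :
    ∑ j ∈ Finset.Icc 1 n with d ∣ j, f j ≤ ∑ i ∈ Finset.Icc 1 (n / d), f (d * i) := by
  classical
  rw [← Finset.sum_image (f := f) (g := fun i => d * i) (by
    intro i _ j _ hij; exact Nat.eq_of_mul_eq_mul_left hd hij)]
  refine Finset.sum_le_sum_of_subset_of_nonneg ?_ fun j _ _ => hf j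
  intro j hj
  simp only [Finset.mem_filter, Finset.mem_Icc] at hj
  obtain ⟨⟨h1, h2⟩, i, rfl⟩ := hj
  rw [Finset.mem_image]
  refine ⟨i, ?_, rfl⟩
  rw [Finset.mem_Icc, Nat.le_div_iff_mul_le hd]
  exact ⟨Nat.pos_of_ne_zero fun hi => by simp [hi] at h1, by rwa [mul_comm]⟩

theorem sum_dvd_inv_le (d n : ℕ) (hd : 0 < d) :
    ∑ j ∈ Finset.Icc 1 n with d ∣ j, (1 / j : ℝ) ≤ (1 + Real.log n) / d := by
  refine (sum_dvd_Icc_le (fun j => (1 / j : ℝ)) (fun j => by positivity) d n hd).trans ?_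
  have : ∀ i ∈ Finset.Icc 1 (n / d), (1 / ((d * i : ℕ) : ℝ)) = (1 / d : ℝ) * (1 / i : ℝ) := by
    intro i _; push_cast; ring
  rw [Finset.sum_congr rfl this, ← Finset.mul_sum,
    div_eq_mul_one_div (1 + Real.log n) (d : ℝ), mul_comm (1 / d : ℝ)]
  refine mul_le_mul_of_nonneg_right ?_ (by positivity : (0 : ℝ) ≤ 1 / d)
  rcases Nat.eq_zero_or_pos (n / d) with h | h
  · rw [h]
    have := Real.log_natCast_nonneg n
    simp; linarith
  · refine (sum_inv_Icc_le _).trans ?_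
    gcongr
    exact_mod_cast Nat.div_le_self n d

theorem card_Ico_filter_intCast_eq_le {q : ℕ} [NeZero q] (x : ℤ) (n : ℕ) (r : ZMod q) :
    (((Finset.Ico x (x + n)).filter fun k : ℤ => (k : ZMod q) = r).card : ℝ) ≤ n / q + 1 := by
  have hq : 0 < (q : ℤ) := by exact_mod_cast NeZero.pos q
  have h1 : ((Finset.Ico x (x + n)).filter fun k : ℤ => (k : ZMod q) = r) =
      (Finset.Ico x (x + n)).filter fun k : ℤ => k ≡ r.valMinAbs [ZMOD q] := by
    refine Finset.filter_congr fun k _ => ?_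
    rw [← ZMod.intCast_eq_intCast_iff, ZMod.coe_valMinAbs]
  have h2 := Int.Ico_filter_modEq_card x (x + n) hq r.valMinAbs
  rw [← h1] at h2
  have h3 : (((((Finset.Ico x (x + n)).filter fun k : ℤ => (k : ZMod q) = r).card : ℤ) : ℚ)) ≤
      n / q + 1 := by
    rw [h2]
    push_cast
    refine max_le ?_ (by positivity)
    have h4 := Int.ceil_lt_add_one (((x : ℚ) + n - r.valMinAbs) / (q : ℚ))
    have h5 := Int.le_ceil (((x : ℚ) - r.valMinAbs) / (q : ℚ))
    have h6 : ((x : ℚ) + n - r.valMinAbs) / (q : ℚ) = ((x : ℚ) - r.valMinAbs) / (q : ℚ) + n / q := by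
      ring
    linarith
  have h4 : ((((((Finset.Ico x (x + n)).filter fun k : ℤ => (k : ZMod q) = r).card : ℤ) : ℚ)) : ℝ) ≤
      ((n / q + 1 : ℚ) : ℝ) := by exact_mod_cast h3
  push_cast at h4
  exact h4

theorem sum_Ico_intCast_le {q : ℕ} [NeZero q] (F : ZMod q → ℝ) (hF : ∀ r, 0 ≤ F r) (x : ℤ)
    (n : ℕ) : ∑ k ∈ Finset.Ico x (x + n), F (k : ZMod q) ≤ (n / q + 1) * ∑ r, F r := by
  rw [← Finset.sum_fiberwise_of_maps_to (t := Finset.univ)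
    (g := fun k : ℤ => (k : ZMod q)) (by simp), Finset.mul_sum]
  refine Finset.sum_le_sum fun r _ => ?_
  have : ∀ k ∈ (Finset.Ico x (x + n)).filter (fun k : ℤ => (k : ZMod q) = r),
      F (k : ZMod q) = F r := by
    intro k hk
    rw [(Finset.mem_filter.mp hk).2]
  rw [Finset.sum_congr rfl this, Finset.sum_const, nsmul_eq_mul]
  exact mul_le_mul_of_nonneg_right (card_Ico_filter_intCast_eq_le x n r) (hF r)

theorem card_mul_eq_le {q : ℕ} [NeZero q] (τ : ℤ) (r : ZMod q) :
    (Finset.univ.filter fun k : ZMod q => (τ : ZMod q) * k = r).card ≤ Int.gcd τ q := by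
  classical
  have hG : 0 < Int.gcd τ q := Int.gcd_pos_of_ne_zero_right _ (by exact_mod_cast NeZero.ne q)
  rcases Finset.eq_empty_or_nonempty
    (Finset.univ.filter fun k : ZMod q => (τ : ZMod q) * k = r) with h | ⟨k₀, hk₀⟩
  · rw [h]; simp
  refine le_trans ?_ (IsAddCyclic.card_nsmul_eq_zero_le (α := ZMod q) hG)
  refine Finset.card_le_card_of_injOn (fun k => k - k₀) ?_ (fun k _ k' _ h => by simpa using h)
  intro k hk
  simp only [Finset.coe_filter, Finset.mem_filter, Finset.mem_univ, true_and,
    Set.mem_ofPred_eq] at hk hk₀ ⊢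
  -- By Bézout the gcd is a multiple of τ modulo q, so it annihilates the difference of two
  -- solutions; a cyclic group has at most that many such elements.
  have h1 : ((Int.gcd τ q : ℤ) : ZMod q) = τ * (Int.gcdA τ q : ZMod q) := by
    rw [Int.gcd_eq_gcd_ab]
    simp
  rw [nsmul_eq_mul, ← Int.cast_natCast, h1, mul_right_comm, mul_sub, hk, hk₀]
  simp

theorem gcd_dvd_natAbs_valMinAbs {q : ℕ} [NeZero q] (τ : ℤ) (k : ZMod q) :
    Int.gcd τ q ∣ ((τ : ZMod q) * k).valMinAbs.natAbs := by
  rw [← Int.natCast_dvd]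
  have h1 : (((τ : ZMod q) * k).valMinAbs : ZMod q) = ((τ * k.valMinAbs : ℤ) : ZMod q) := by
    simp
  rw [ZMod.intCast_eq_intCast_iff_dvd_sub] at h1
  have h2 := (Int.gcd_dvd_right τ q).trans h1
  have h3 : (Int.gcd τ q : ℤ) ∣ τ * k.valMinAbs := (Int.gcd_dvd_left τ q).mul_right _
  have h4 := h3.sub h2
  simpa using h4

/-- With G = gcd(τ, q), the map k ↦ τk has fibres of size at most G and takes only values divisible
by G. The factor G lost in the fibres is regained in the harmonic sum over multiples of G, so G
multiplies only the term N of the zero residue. -/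
theorem sum_geomBound_mul_le {q : ℕ} [NeZero q] (N : ℝ) (hN : 0 ≤ N) (τ : ℤ) :
    ∑ k : ZMod q, geomBound q N ((τ : ZMod q) * k) ≤
      Int.gcd τ q * N + q * (1 + Real.log q) := by
  classical
  have hq : (0 : ℝ) < q := by exact_mod_cast NeZero.pos q
  set G := Int.gcd τ q with hGdef
  have hG : 0 < G := Int.gcd_pos_of_ne_zero_right _ (by exact_mod_cast NeZero.ne q)
  have hGr : (0 : ℝ) < G := by exact_mod_cast hG
  let F : ℕ → ℝ := fun j => if G ∣ j then q / (2 * j) else 0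
  have hF : ∀ j, 0 ≤ F j := by
    intro j; simp only [F]; split_ifs <;> positivity
  have h1 : ∑ k : ZMod q, geomBound q N ((τ : ZMod q) * k) ≤
      ∑ r : ZMod q, G * (if r = 0 then N else F r.valMinAbs.natAbs) := by
    rw [← Finset.sum_fiberwise_of_maps_to (t := Finset.univ)
      (g := fun k : ZMod q => (τ : ZMod q) * k) (by simp)]
    refine Finset.sum_le_sum fun r _ => ?_
    calc _ ≤ ∑ k ∈ (Finset.univ.filter fun k : ZMod q => (τ : ZMod q) * k = r),
          (if r = 0 then N else F r.valMinAbs.natAbs) := by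
          refine Finset.sum_le_sum fun k hk => ?_
          have hk' := (Finset.mem_filter.mp hk).2
          have hd := gcd_dvd_natAbs_valMinAbs τ k
          rw [hk'] at hd ⊢
          simp only [geomBound, F]
          rw [if_pos hd]
          split_ifs
          · exact le_rfl
          · rw [Nat.cast_natAbs]; simp
      _ ≤ _ := by
          rw [Finset.sum_const, nsmul_eq_mul]
          refine mul_le_mul_of_nonneg_right (by exact_mod_cast card_mul_eq_le τ r) ?_
          split_ifs
          · exact hN
          · exact hF _
  refine h1.trans ?_
  rw [← Finset.mul_sum, ← Finset.sum_filter_add_sum_filter_not Finset.univ (fun r : ZMod q => r = 0)]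
  have h2 : ∑ r : ZMod q with r = 0, (if r = 0 then N else F r.valMinAbs.natAbs) = N := by
    rw [Finset.filter_eq' Finset.univ (0 : ZMod q)]; simp
  have h3 : ∑ r : ZMod q with ¬ r = 0, (if r = 0 then N else F r.valMinAbs.natAbs) ≤
      q * (1 + Real.log q) / G := by
    calc _ = ∑ r : ZMod q with r ≠ 0, F r.valMinAbs.natAbs := by
          refine Finset.sum_congr rfl fun r hr => ?_
          rw [if_neg (Finset.mem_filter.mp hr).2]
      _ ≤ 2 * ∑ j ∈ Finset.Icc 1 (q / 2), F j := sum_zmod_ne_zero_le F hF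
      _ ≤ 2 * ∑ j ∈ Finset.Icc 1 q, F j := by
          refine mul_le_mul_of_nonneg_left ?_ zero_le_two
          exact Finset.sum_le_sum_of_subset_of_nonneg
            (Finset.Icc_subset_Icc_right (Nat.div_le_self q 2)) fun _ _ _ => hF _
      _ = q * ∑ j ∈ Finset.Icc 1 q with G ∣ j, (1 / j : ℝ) := by
          rw [Finset.sum_filter, Finset.mul_sum, Finset.mul_sum]
          refine Finset.sum_congr rfl fun j _ => ?_
          simp only [F]
          split_ifs
          · ring
          · ring
      _ ≤ q * ((1 + Real.log q) / G) := by
          gcongr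
          exact sum_dvd_inv_le G q hG
      _ = _ := by ring
  rw [h2]
  calc (G : ℝ) * (N + _) ≤ G * (N + q * (1 + Real.log q) / G) := by gcongr
    _ = _ := by field_simp

/-! ### Quadratic exponential sums and squares modulo q -/

-- The shifts k of Weyl differencing run through 2N consecutive integers, which meet each class
-- modulo q at most 2N/q + 1 times.
open ZMod in
theorem norm_sq_quadratic_sum_le {q : ℕ} [NeZero q] (h : ZMod q) (x : ℤ) (N : ℕ) :
    ‖∑ b ∈ Finset.Ico x (x + N), stdAddChar (h * (b : ZMod q) ^ 2)‖ ^ 2 ≤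
      (2 * N / q + 1) * (Int.gcd (2 * h.valMinAbs) q * N + q * (1 + Real.log q)) := by
  refine (norm_sq_sum_stdAddChar_sq_le h x N).trans ?_
  have h1 := sum_Ico_intCast_le (fun k : ZMod q => geomBound q N (2 * h * k))
    (fun r => geomBound_nonneg (Nat.cast_nonneg N) _) (-N) (2 * N)
  have h2 : (-N : ℤ) + (2 * N : ℕ) = N := by push_cast; ring
  rw [h2] at h1
  push_cast at h1
  refine h1.trans ?_
  have h3 := sum_geomBound_mul_le (q := q) N (Nat.cast_nonneg N) (2 * h.valMinAbs)
  simp only [Int.cast_mul, Int.cast_ofNat, ZMod.coe_valMinAbs] at h3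
  gcongr

open ZMod in
/-- Counting the solutions of `b ^ 2 ≡ d` modulo `q` in a box, up to quadratic exponential sums. -/
theorem abs_card_sq_eq_sub_le {q : ℕ} [NeZero q] (I : Finset ℤ) (M : ℕ) :
    |((((I ×ˢ Finset.Icc (-M : ℤ) M).filter
        fun p => ((p.1 : ZMod q)) ^ 2 = (p.2 : ZMod q)).card : ℝ) - I.card * (2 * M + 1) / q)| ≤
      ∑ h : ZMod q with h ≠ 0,
        ‖∑ b ∈ I, stdAddChar (h * (b : ZMod q) ^ 2)‖ / (2 * |(h.valMinAbs : ℝ)|) := by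
  classical
  have hq : (0 : ℝ) < q := by exact_mod_cast NeZero.pos q
  have hqC : (q : ℂ) ≠ 0 := by exact_mod_cast hq.ne'
  set J := Finset.Icc (-M : ℤ) M with hJ
  have hJcard : (J.card : ℂ) = 2 * M + 1 := by
    have : J.card = 2 * M + 1 := by rw [hJ, Int.card_Icc]; omega
    rw [this]; push_cast; ring
  have h1 : ((((I ×ˢ J).filter fun p => ((p.1 : ZMod q)) ^ 2 = (p.2 : ZMod q)).card : ℂ)) =
      1 / q * ∑ h : ZMod q, (∑ b ∈ I, stdAddChar (h * (b : ZMod q) ^ 2)) *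
        ∑ d ∈ J, stdAddChar (-h * (d : ZMod q)) := by
    have : ∀ h : ZMod q, (∑ b ∈ I, stdAddChar (h * (b : ZMod q) ^ 2)) *
        ∑ d ∈ J, stdAddChar (-h * (d : ZMod q)) =
        ∑ p ∈ I ×ˢ J, stdAddChar (h * ((p.1 : ZMod q) ^ 2 - (p.2 : ZMod q))) := by
      intro h
      rw [Finset.sum_mul_sum, ← Finset.sum_product']
      refine Finset.sum_congr rfl fun p _ => ?_
      rw [← AddChar.map_add_eq_mul]
      congr 1
      ring
    simp_rw [this]
    rw [Finset.sum_comm]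
    -- Orthogonality of characters detects the congruence; the frequency h = 0, split off next, is
    -- the main term.
    simp_rw [AddChar.sum_mulShift _ (isPrimitive_stdAddChar q), ZMod.card, sub_eq_zero]
    push_cast
    rw [← Finset.sum_filter, Finset.sum_const, nsmul_eq_mul]
    field_simp
  rw [← Finset.sum_filter_add_sum_filter_not Finset.univ (fun h : ZMod q => h = 0),
    Finset.filter_eq' Finset.univ (0 : ZMod q)] at h1
  simp only [Finset.mem_univ, if_true, Finset.sum_singleton, zero_mul, neg_zero,
    AddChar.map_zero_eq_one, Finset.sum_const, nsmul_eq_mul, mul_one, hJcard] at h1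
  have h2 : (((((I ×ˢ J).filter fun p => ((p.1 : ZMod q)) ^ 2 = (p.2 : ZMod q)).card : ℝ) -
      I.card * (2 * M + 1) / q : ℝ) : ℂ) =
      1 / q * ∑ h : ZMod q with ¬ h = 0, (∑ b ∈ I, stdAddChar (h * (b : ZMod q) ^ 2)) *
        ∑ d ∈ J, stdAddChar (-h * (d : ZMod q)) := by
    push_cast
    rw [h1]
    ring
  rw [← Real.norm_eq_abs, ← Complex.norm_real, h2, norm_mul]
  have h3 : ‖(1 / q : ℂ)‖ = 1 / q := by simp
  rw [h3]
  refine (mul_le_mul_of_nonneg_left (norm_sum_le _ _) (by positivity)).trans ?_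
  rw [Finset.mul_sum]
  refine Finset.sum_le_sum fun h hh => ?_
  have hh' : h ≠ 0 := (Finset.mem_filter.mp hh).2
  have hm : 0 < |(h.valMinAbs : ℝ)| := by simpa using hh'
  rw [norm_mul]
  -- The sum over d is geometric with h ≠ 0, so its bound does not depend on M.
  have h4 : ‖∑ d ∈ J, stdAddChar (-h * (d : ZMod q))‖ ≤ q / (2 * |(h.valMinAbs : ℝ)|) := by
    have h5 := norm_sum_stdAddChar_mul_le (-h) (-M : ℤ) (M + 1) (2 * M + 1) (by positivity)
      (by push_cast; linarith)
    have h6 : Finset.Ico (-M : ℤ) (M + 1) = J := by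
      ext; simp [hJ, Finset.mem_Ico, Finset.mem_Icc]
    have h7 : |((-h).valMinAbs : ℝ)| = |(h.valMinAbs : ℝ)| := by
      have := ZMod.natAbs_valMinAbs_neg h
      rw [← Int.cast_abs, ← Int.cast_abs, Int.abs_eq_natAbs, Int.abs_eq_natAbs, this]
    rw [h6, geomBound, if_neg (neg_ne_zero.mpr hh'), h7] at h5
    exact h5
  calc 1 / (q : ℝ) * (‖∑ b ∈ I, stdAddChar (h * (b : ZMod q) ^ 2)‖ *
        ‖∑ d ∈ J, stdAddChar (-h * (d : ZMod q))‖)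
      ≤ 1 / (q : ℝ) * (‖∑ b ∈ I, stdAddChar (h * (b : ZMod q) ^ 2)‖ *
        (q / (2 * |(h.valMinAbs : ℝ)|))) := by gcongr
    _ = _ := by field_simp

/-! ### Averaging over the moduli 4a -/

theorem sum_inv_sqrt_Icc_le (n : ℕ) : ∑ i ∈ Finset.Icc 1 n, 1 / √(i : ℝ) ≤ 2 * √(n : ℝ) := by
  induction n with
  | zero => simp
  | succ n ih =>
    rw [Finset.sum_Icc_succ_top (by omega)]
    have hs : √(n : ℝ) ^ 2 = n := Real.sq_sqrt (by positivity)
    have ht : √((n + 1 : ℕ) : ℝ) ^ 2 = n + 1 := by rw [Real.sq_sqrt (by positivity)]; push_cast; rfl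
    have ht0 : 0 < √((n + 1 : ℕ) : ℝ) := Real.sqrt_pos.mpr (by positivity)
    -- With t² = s² + 1, the inequality (t - s)² ≥ 0 reads 2ts ≤ 2t² - 1.
    have key : 1 / √((n + 1 : ℕ) : ℝ) ≤ 2 * √((n + 1 : ℕ) : ℝ) - 2 * √(n : ℝ) := by
      rw [div_le_iff₀ ht0]
      nlinarith [sq_nonneg (√((n + 1 : ℕ) : ℝ) - √(n : ℝ))]
    linarith

theorem sum_inv_sqrt_dvd_le (d R : ℕ) (hd : 0 < d) :
    ∑ a ∈ Finset.Icc 1 R with d ∣ 2 * a, 1 / √(a : ℝ) ≤ 4 * √(R : ℝ) / d := by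
  have hd' : (0 : ℝ) < d := by exact_mod_cast hd
  -- Chosen so that f(2a) = 1/√a; the sum then extends to all multiples of d up to 2R.
  let f : ℕ → ℝ := fun n => √2 / √(n : ℝ)
  have hf : ∀ n, 0 ≤ f n := fun n => by positivity
  calc ∑ a ∈ Finset.Icc 1 R with d ∣ 2 * a, 1 / √(a : ℝ)
      = ∑ a ∈ Finset.Icc 1 R with d ∣ 2 * a, f (2 * a) := by
        refine Finset.sum_congr rfl fun a _ => ?_
        simp only [f]
        push_cast
        rw [Real.sqrt_mul zero_le_two]
        field_simp
    _ ≤ ∑ n ∈ Finset.Icc 1 (2 * R) with d ∣ n, f n := by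
        rw [← Finset.sum_image (f := f) (g := fun a => 2 * a) (by
          intro i _ j _ hij; exact Nat.eq_of_mul_eq_mul_left two_pos hij)]
        refine Finset.sum_le_sum_of_subset_of_nonneg ?_ fun j _ _ => hf j
        intro n hn
        simp only [Finset.mem_image, Finset.mem_filter, Finset.mem_Icc] at hn ⊢
        obtain ⟨a, ⟨⟨h1, h2⟩, h3⟩, rfl⟩ := hn
        exact ⟨by omega, h3⟩
    _ ≤ ∑ i ∈ Finset.Icc 1 (2 * R / d), f (d * i) := sum_dvd_Icc_le f hf d _ hd
    _ = √2 / √(d : ℝ) * ∑ i ∈ Finset.Icc 1 (2 * R / d), 1 / √(i : ℝ) := by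
        rw [Finset.mul_sum]
        refine Finset.sum_congr rfl fun i _ => ?_
        simp only [f]
        push_cast
        rw [Real.sqrt_mul (by positivity)]
        field_simp
    _ ≤ √2 / √(d : ℝ) * (2 * √((2 * R / d : ℕ) : ℝ)) := by
        gcongr
        exact sum_inv_sqrt_Icc_le _
    _ ≤ √2 / √(d : ℝ) * (2 * √(2 * R / d : ℝ)) := by
        gcongr
        exact (Nat.cast_div_le).trans (by push_cast; rfl)
    _ = 4 * √(R : ℝ) / d := by
        rw [Real.sqrt_div (by positivity), Real.sqrt_mul zero_le_two]
        have h1 : √(d : ℝ) * √(d : ℝ) = d := Real.mul_self_sqrt (by positivity)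
        have h2 : √(2 : ℝ) * √2 = 2 := Real.mul_self_sqrt (by positivity)
        calc √2 / √(d : ℝ) * (2 * (√2 * √(R : ℝ) / √(d : ℝ)))
            = (√2 * √2) * 2 * √(R : ℝ) / (√(d : ℝ) * √(d : ℝ)) := by ring
          _ = _ := by rw [h1, h2]; ring

/-- The gcd is itself one of the common divisors d. The cruder right-hand side is useful because it
separates the variables j and n. -/
theorem sqrt_gcd_le_sum (j n X : ℕ) (hj : 0 < j) (hX : j ≤ X) :
    √(Nat.gcd j n : ℝ) ≤ ∑ d ∈ Finset.Icc 1 X, if d ∣ j ∧ d ∣ n then √(d : ℝ) else 0 := by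
  have hmem : Nat.gcd j n ∈ Finset.Icc 1 X :=
    Finset.mem_Icc.mpr ⟨Nat.gcd_pos_of_pos_left _ hj, (Nat.gcd_le_left _ hj).trans hX⟩
  have := Finset.single_le_sum (f := fun d : ℕ => if d ∣ j ∧ d ∣ n then √(d : ℝ) else 0)
    (fun d _ => by positivity) hmem
  simpa [Nat.gcd_dvd_left, Nat.gcd_dvd_right] using this

/-- After the gcd is replaced by a sum over common divisors d, the sums over j and a factor and each
saves a factor d, leaving the convergent series of √d / d². -/
theorem exists_sum_sqrt_gcd_le : ∃ C : ℝ, 0 < C ∧ ∀ R : ℕ,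
    ∑ a ∈ Finset.Icc 1 R, ∑ j ∈ Finset.Icc 1 (2 * R),
      (1 / j : ℝ) * (√(Nat.gcd j (2 * a) : ℝ) / √(a : ℝ)) ≤
        C * (√(R : ℝ) * (1 + Real.log (2 * R))) := by
  have hsum : Summable fun d : ℕ => √(d : ℝ) / (d : ℝ) ^ 2 := by
    have h := Real.summable_one_div_nat_rpow.mpr (show (1 : ℝ) < 3 / 2 by norm_num)
    refine h.congr fun d => ?_
    rcases Nat.eq_zero_or_pos d with rfl | hd
    · rw [Nat.cast_zero, Real.zero_rpow (by norm_num)]; simp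
    · have hd' : (0 : ℝ) < d := by exact_mod_cast hd
      rw [Real.sqrt_eq_rpow, ← Real.rpow_natCast, ← Real.rpow_sub hd', one_div,
        ← Real.rpow_neg hd'.le]
      norm_num
  refine ⟨4 * (∑' d : ℕ, √(d : ℝ) / (d : ℝ) ^ 2) + 1, by positivity, fun R => ?_⟩
  rcases Nat.eq_zero_or_pos R with rfl | hR
  · simp
  have hlog : 0 ≤ 1 + Real.log (2 * R) := by
    have := Real.log_natCast_nonneg (2 * R)
    push_cast at this
    linarith
  set T := ∑' d : ℕ, √(d : ℝ) / (d : ℝ) ^ 2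
  calc ∑ a ∈ Finset.Icc 1 R, ∑ j ∈ Finset.Icc 1 (2 * R),
        (1 / j : ℝ) * (√(Nat.gcd j (2 * a) : ℝ) / √(a : ℝ))
      ≤ ∑ a ∈ Finset.Icc 1 R, ∑ j ∈ Finset.Icc 1 (2 * R), (1 / j : ℝ) *
          ((∑ d ∈ Finset.Icc 1 (2 * R), if d ∣ j ∧ d ∣ 2 * a then √(d : ℝ) else 0) / √(a : ℝ)) := by
        refine Finset.sum_le_sum fun a _ => Finset.sum_le_sum fun j hj => ?_
        rw [Finset.mem_Icc] at hj
        gcongr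
        exact sqrt_gcd_le_sum j (2 * a) (2 * R) hj.1 hj.2
    _ = ∑ d ∈ Finset.Icc 1 (2 * R), √(d : ℝ) *
          ((∑ j ∈ Finset.Icc 1 (2 * R) with d ∣ j, (1 / j : ℝ)) *
            ∑ a ∈ Finset.Icc 1 R with d ∣ 2 * a, 1 / √(a : ℝ)) := by
        simp_rw [Finset.sum_filter, Finset.sum_mul_sum, Finset.sum_div, Finset.mul_sum]
        rw [Finset.sum_congr rfl fun a _ => Finset.sum_comm, Finset.sum_comm]
        refine Finset.sum_congr rfl fun d _ => ?_
        rw [Finset.sum_comm]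
        refine Finset.sum_congr rfl fun j _ => Finset.sum_congr rfl fun a _ => ?_
        by_cases h1 : d ∣ j <;> by_cases h2 : d ∣ 2 * a <;> simp only [h1, h2, if_true, if_false,
          and_self, and_true, and_false] <;> ring
    _ ≤ ∑ d ∈ Finset.Icc 1 (2 * R), √(d : ℝ) *
          (((1 + Real.log (2 * R)) / d) * (4 * √(R : ℝ) / d)) := by
        refine Finset.sum_le_sum fun d hd => ?_
        rw [Finset.mem_Icc] at hd
        have h1 := sum_dvd_inv_le d (2 * R) hd.1
        push_cast at h1
        have h2 := sum_inv_sqrt_dvd_le d R hd.1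
        gcongr
    _ = 4 * (√(R : ℝ) * (1 + Real.log (2 * R))) *
          ∑ d ∈ Finset.Icc 1 (2 * R), √(d : ℝ) / (d : ℝ) ^ 2 := by
        rw [Finset.mul_sum]
        refine Finset.sum_congr rfl fun d _ => ?_
        ring
    _ ≤ 4 * (√(R : ℝ) * (1 + Real.log (2 * R))) * T := by
        gcongr
        exact hsum.sum_le_tsum _ fun d _ => by positivity
    _ ≤ (4 * T + 1) * (√(R : ℝ) * (1 + Real.log (2 * R))) := by
        have : 0 ≤ √(R : ℝ) * (1 + Real.log (2 * R)) := by positivity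
        linarith

-- Weyl's bound for q = 4a, with the square root taken of each term separately. The hypothesis a ≤ R
-- lets the factor 2N/q + 1 be absorbed into 5R/(2a).
open ZMod in
theorem norm_quadratic_sum_le {a R β : ℕ} [NeZero (4 * a)] (ha : 1 ≤ a) (haR : a ≤ R) (hβ : β ≤ R)
    (h : ZMod (4 * a)) :
    ‖∑ b ∈ Finset.Icc (-β : ℤ) β,
        stdAddChar (h * (b : ZMod (4 * a)) ^ 2)‖ ≤
      4 * R * (√(Nat.gcd h.valMinAbs.natAbs (2 * a) : ℝ) / √(a : ℝ)) +
        4 * √(R * (1 + Real.log (4 * R))) := by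
  have h1 := norm_sq_quadratic_sum_le h (-β : ℤ) (2 * β + 1)
  have hI : Finset.Ico (-β : ℤ) (-β + (2 * β + 1 : ℕ)) = Finset.Icc (-β : ℤ) β := by
    ext b; rw [Finset.mem_Ico, Finset.mem_Icc]; push_cast; omega
  rw [hI] at h1
  have hg : Int.gcd (2 * h.valMinAbs) ((4 * a : ℕ) : ℤ) = 2 * Nat.gcd h.valMinAbs.natAbs (2 * a) := by
    rw [Int.gcd, Int.natAbs_mul, Int.natAbs_natCast]
    generalize h.valMinAbs.natAbs = m
    rw [show 4 * a = 2 * (2 * a) by ring]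
    exact Nat.gcd_mul_left _ _ _
  rw [hg] at h1
  set g := Nat.gcd h.valMinAbs.natAbs (2 * a)
  push_cast at h1
  have haR' : (a : ℝ) ≤ R := by exact_mod_cast haR
  have ha' : (1 : ℝ) ≤ a := by exact_mod_cast ha
  have ha0 : (0 : ℝ) < a := by linarith
  have hR' : (1 : ℝ) ≤ R := ha'.trans haR'
  have hβ' : (β : ℝ) ≤ R := by exact_mod_cast hβ
  have hN : (2 * β + 1 : ℝ) ≤ 3 * R := by linarith
  have hL : 1 + Real.log (4 * a) ≤ 1 + Real.log (4 * R) := by gcongr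
  have hLa : 0 ≤ 1 + Real.log (4 * a) := by
    have := Real.log_nonneg (show (1 : ℝ) ≤ 4 * a by linarith)
    linarith
  set L := 1 + Real.log (4 * R)
  have hL0 : 0 ≤ L := hLa.trans hL
  refine abs_le_of_sq_le_sq' ?_ (by positivity) |>.2
  refine h1.trans ?_
  have hA : (2 * (2 * β + 1) / (4 * a) + 1 : ℝ) ≤ 5 * R / (2 * a) := by
    rw [div_add_one (by positivity), div_le_div_iff₀ (by positivity) (by positivity)]
    nlinarith
  have hB : (2 * g * (2 * β + 1) + 4 * a * (1 + Real.log (4 * a)) : ℝ) ≤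
      2 * g * (3 * R) + 4 * a * L := by gcongr
  calc _ ≤ 5 * R / (2 * a) * (2 * g * (3 * R) + 4 * a * L) := by gcongr
    _ = 15 * R ^ 2 * (g / a) + 10 * (R * L) := by field_simp; ring
    _ ≤ 16 * R ^ 2 * (g / a) + 16 * (R * L) := by
        gcongr <;> norm_num
    _ = (4 * R * (√(g : ℝ) / √(a : ℝ))) ^ 2 + (4 * √(R * L)) ^ 2 := by
        rw [mul_pow, mul_pow, mul_pow, div_pow, Real.sq_sqrt (by positivity),
          Real.sq_sqrt (by positivity), Real.sq_sqrt (by positivity)]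
        ring
    _ ≤ _ := by
        rw [add_sq]
        have : 0 ≤ 2 * (4 * R * (√(g : ℝ) / √(a : ℝ))) * (4 * √(R * L)) := by positivity
        linarith

theorem abs_card_sq_sub_le {a R β : ℕ} (ha : 1 ≤ a) (haR : a ≤ R) (hβ : β ≤ R) (M : ℕ) :
    |((((Finset.Icc (-β : ℤ) β ×ˢ Finset.Icc (-M : ℤ) M).filter
        fun p => ((4 * a : ℕ) : ℤ) ∣ p.1 ^ 2 - p.2).card : ℝ) -
          (2 * β + 1) * (2 * M + 1) / (4 * a))| ≤
      ∑ j ∈ Finset.Icc 1 (2 * R), (1 / j : ℝ) *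
        (4 * R * (√(Nat.gcd j (2 * a) : ℝ) / √(a : ℝ)) + 4 * √(R * (1 + Real.log (4 * R)))) := by
  have : NeZero (4 * a) := ⟨by omega⟩
  let F : ℕ → ℝ := fun j => (4 * R * (√(Nat.gcd j (2 * a) : ℝ) / √(a : ℝ)) +
    4 * √(R * (1 + Real.log (4 * R)))) / (2 * j)
  have hF : ∀ j, 0 ≤ F j := fun j => by positivity
  have h1 := abs_card_sq_eq_sub_le (q := 4 * a) (Finset.Icc (-β : ℤ) β) M
  have hfil : ((Finset.Icc (-β : ℤ) β ×ˢ Finset.Icc (-M : ℤ) M).filter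
      fun p => ((p.1 : ZMod (4 * a))) ^ 2 = (p.2 : ZMod (4 * a))) =
      (Finset.Icc (-β : ℤ) β ×ˢ Finset.Icc (-M : ℤ) M).filter
        fun p => ((4 * a : ℕ) : ℤ) ∣ p.1 ^ 2 - p.2 := by
    refine Finset.filter_congr fun p _ => ?_
    rw [← ZMod.intCast_eq_intCast_iff_dvd_sub, Int.cast_pow, eq_comm]
  have hcard : ((Finset.Icc (-β : ℤ) β).card : ℝ) = 2 * β + 1 := by
    have : (Finset.Icc (-β : ℤ) β).card = 2 * β + 1 := by rw [Int.card_Icc]; omega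
    rw [this]; push_cast; ring
  rw [hfil, hcard] at h1
  push_cast at h1 ⊢
  refine h1.trans ?_
  calc _ ≤ ∑ h : ZMod (4 * a) with h ≠ 0, F h.valMinAbs.natAbs := by
        refine Finset.sum_le_sum fun h _ => ?_
        simp only [F]
        rw [Nat.cast_natAbs, Int.cast_abs]
        gcongr
        exact norm_quadratic_sum_le ha haR hβ h
    -- The factor 2 from ±h cancels the 2 in the weight 1/(2|h|).
    _ ≤ 2 * ∑ j ∈ Finset.Icc 1 (4 * a / 2), F j := sum_zmod_ne_zero_le F hF
    _ ≤ 2 * ∑ j ∈ Finset.Icc 1 (2 * R), F j := by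
        refine mul_le_mul_of_nonneg_left ?_ zero_le_two
        exact Finset.sum_le_sum_of_subset_of_nonneg
          (Finset.Icc_subset_Icc_right (by omega)) fun _ _ _ => hF _
    _ = _ := by
        rw [Finset.mul_sum]
        refine Finset.sum_congr rfl fun j _ => ?_
        simp only [F]
        ring

theorem exists_sum_abs_card_sq_sub_le : ∃ C : ℝ, 0 < C ∧ ∀ (R M : ℕ) (β : ℕ → ℕ),
    (∀ a, β a ≤ R) →
    ∑ a ∈ Finset.Icc 1 R, |((((Finset.Icc (-β a : ℤ) (β a) ×ˢ Finset.Icc (-M : ℤ) M).filter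
        fun p => ((4 * a : ℕ) : ℤ) ∣ p.1 ^ 2 - p.2).card : ℝ) -
          (2 * β a + 1) * (2 * M + 1) / (4 * a))| ≤
      C * (R * (1 + Real.log (4 * R)) * √(R * (1 + Real.log (4 * R)))) := by
  obtain ⟨C, hC, hgcd⟩ := exists_sum_sqrt_gcd_le
  refine ⟨4 * C + 4, by positivity, fun R M β hβ => ?_⟩
  rcases Nat.eq_zero_or_pos R with rfl | hR
  · simp
  have hR' : (1 : ℝ) ≤ R := by exact_mod_cast hR
  have hlog2 : 0 ≤ Real.log (2 * R) := Real.log_nonneg (by linarith)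
  have hlog : Real.log (2 * R) ≤ Real.log (4 * R) := by gcongr; norm_num
  set L := 1 + Real.log (4 * R) with hL
  have hL1 : 1 ≤ L := by linarith
  calc _ ≤ ∑ a ∈ Finset.Icc 1 R, ∑ j ∈ Finset.Icc 1 (2 * R), (1 / j : ℝ) *
        (4 * R * (√(Nat.gcd j (2 * a) : ℝ) / √(a : ℝ)) + 4 * √(R * L)) := by
        refine Finset.sum_le_sum fun a ha => ?_
        rw [Finset.mem_Icc] at ha
        exact abs_card_sq_sub_le ha.1 ha.2 (hβ a) M
    _ = 4 * R * (∑ a ∈ Finset.Icc 1 R, ∑ j ∈ Finset.Icc 1 (2 * R),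
          (1 / j : ℝ) * (√(Nat.gcd j (2 * a) : ℝ) / √(a : ℝ))) +
        R * (4 * √(R * L) * ∑ j ∈ Finset.Icc 1 (2 * R), (1 / j : ℝ)) := by
        have : (R : ℝ) * (4 * √(R * L) * ∑ j ∈ Finset.Icc 1 (2 * R), (1 / j : ℝ)) =
            ∑ a ∈ Finset.Icc 1 R, 4 * √(R * L) * ∑ j ∈ Finset.Icc 1 (2 * R), (1 / j : ℝ) := by
          rw [Finset.sum_const, Nat.card_Icc, nsmul_eq_mul]; simp
        rw [this, Finset.mul_sum, ← Finset.sum_add_distrib]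
        refine Finset.sum_congr rfl fun a _ => ?_
        rw [Finset.mul_sum, Finset.mul_sum, ← Finset.sum_add_distrib]
        refine Finset.sum_congr rfl fun j _ => ?_
        ring
    _ ≤ 4 * R * (C * (√(R : ℝ) * L)) + R * (4 * √(R * L) * L) := by
        have h1 := hgcd R
        have h2 := sum_inv_Icc_le (2 * R)
        push_cast at h2
        gcongr
        · refine h1.trans ?_
          gcongr
          linarith
        · linarith
    _ ≤ 4 * R * (C * (√(R * L) * L)) + R * (4 * √(R * L) * L) := by
        gcongr
        nlinarith
    _ = _ := by ring

/-! ### From pairs (b, c) to pairs (b, d) -/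

/-- If b₀ has the least absolute value among these b, then b² - b₀² ≤ 2M, which forces |b| - |b₀| ≤
√(2M). The bound is therefore uniform in X and R. -/
theorem card_abs_sq_sub_le (R M : ℕ) (X : ℤ) (hM : 1 ≤ M) :
    (((Finset.Icc (-R : ℤ) R).filter fun b : ℤ => |b ^ 2 - X| ≤ (M : ℤ)).card : ℝ) ≤ 5 * √(M : ℝ) := by
  classical
  set B := (Finset.Icc (-R : ℤ) R).filter fun b : ℤ => |b ^ 2 - X| ≤ (M : ℤ) with hB
  rcases B.eq_empty_or_nonempty with h | h
  · rw [h]; simp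
  obtain ⟨b₀, hb₀, hmin⟩ := B.exists_min_image (fun b => |b|) h
  set s : ℕ := Nat.sqrt (2 * M)
  have hs : 2 * M < (s + 1) ^ 2 := by rw [pow_two]; exact Nat.lt_succ_sqrt _
  have hsub : B ⊆ Finset.Icc |b₀| (|b₀| + s) ∪ Finset.Icc (-|b₀| - s) (-|b₀|) := by
    intro b hb
    have h1 := hmin b hb
    have h2 := (Finset.mem_filter.mp hb).2
    have h3 := (Finset.mem_filter.mp hb₀).2
    rw [abs_le] at h2 h3
    have h4 : |b| < |b₀| + (s + 1 : ℤ) := by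
      by_contra hcon
      push Not at hcon
      have h5 : ((s : ℤ) + 1) ^ 2 ≤ b ^ 2 - b₀ ^ 2 := by
        rw [← sq_abs b, ← sq_abs b₀]
        nlinarith [abs_nonneg b₀]
      have h6 : (2 * M : ℤ) < (s + 1) ^ 2 := by exact_mod_cast hs
      linarith
    rw [Finset.mem_union, Finset.mem_Icc, Finset.mem_Icc]
    rcases abs_cases b with h5 | h5 <;> omega
  have hcard : B.card ≤ 2 * (s + 1) := by
    refine (Finset.card_le_card hsub).trans ((Finset.card_union_le _ _).trans ?_)
    rw [Int.card_Icc, Int.card_Icc]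
    omega
  have hM' : (1 : ℝ) ≤ √(M : ℝ) := Real.one_le_sqrt.mpr (by exact_mod_cast hM)
  have hs' : (s : ℝ) ≤ 3 / 2 * √(M : ℝ) := by
    refine (Real.nat_sqrt_le_real_sqrt).trans ?_
    rw [Real.sqrt_le_left (by positivity), mul_pow, Real.sq_sqrt (by positivity)]
    push_cast
    have : (0 : ℝ) ≤ M := by positivity
    linarith
  have : (B.card : ℝ) ≤ 2 * (s + 1) := by exact_mod_cast hcard
  linarith

/-- The pairs `(b, c)` for which `a x ^ 2 + b x + c` has `|b|, |c| ≤ R` and discriminant at most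
`M` in absolute value. -/
noncomputable def quadPairs (R M : ℕ) (a : ℤ) : Finset (ℤ × ℤ) :=
  (Finset.Icc (-R : ℤ) R ×ˢ Finset.Icc (-R : ℤ) R).filter
    fun p : ℤ × ℤ => |p.1 ^ 2 - 4 * a * p.2| ≤ (M : ℤ)

/-- The pairs `(b, d)` with `|b| ≤ β`, `|d| ≤ M` and `b ^ 2 ≡ d` modulo `4 * a`. -/
noncomputable def sqResiduePairs (β M a : ℕ) : Finset (ℤ × ℤ) :=
  (Finset.Icc (-β : ℤ) β ×ˢ Finset.Icc (-M : ℤ) M).filter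
    fun p => ((4 * a : ℕ) : ℤ) ∣ p.1 ^ 2 - p.2

theorem card_quadPairs_neg (R M : ℕ) (a : ℤ) :
    (quadPairs R M (-a)).card = (quadPairs R M a).card := by
  refine Finset.card_nbij' (fun p => (p.1, -p.2)) (fun p => (p.1, -p.2)) ?_ ?_ ?_ ?_
  · intro p hp
    simp only [quadPairs, Finset.coe_filter, Finset.mem_product, Finset.mem_Icc,
      Set.mem_ofPred_eq] at hp ⊢
    refine ⟨⟨hp.1.1, by omega⟩, ?_⟩
    have := hp.2
    rwa [show p.1 ^ 2 - 4 * -a * p.2 = p.1 ^ 2 - 4 * a * -p.2 by ring] at this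
  · intro p hp
    simp only [quadPairs, Finset.coe_filter, Finset.mem_product, Finset.mem_Icc,
      Set.mem_ofPred_eq] at hp ⊢
    refine ⟨⟨hp.1.1, by omega⟩, ?_⟩
    have := hp.2
    rwa [show p.1 ^ 2 - 4 * -a * -p.2 = p.1 ^ 2 - 4 * a * p.2 by ring]
  · intro p _; simp
  · intro p _; simp

/-- The pairs in which `quadPairs` and `sqResiduePairs` may differ. -/
noncomputable def boundaryPairs (R M a : ℕ) : Finset (ℤ × ℤ) :=
  (((Finset.Icc (-R : ℤ) R).filter fun b : ℤ => |b ^ 2 - 4 * a * R| ≤ (M : ℤ)) ×ˢ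
    Finset.Icc (-M : ℤ) M).filter fun p => ((4 * a : ℕ) : ℤ) ∣ p.1 ^ 2 - p.2

theorem card_boundaryPairs_le (R M a : ℕ) (ha : 1 ≤ a) (hM : 1 ≤ M) :
    ((boundaryPairs R M a).card : ℝ) ≤ 5 * √(M : ℝ) * (M / a + 1) := by
  have : NeZero (4 * a) := ⟨by omega⟩
  have ha' : (0 : ℝ) < a := by exact_mod_cast ha
  have hM' : (1 : ℝ) ≤ M := by exact_mod_cast hM
  rw [boundaryPairs, Finset.card_filter, Finset.sum_product, Nat.cast_sum]
  have h1 : ∀ b : ℤ, ((∑ d ∈ Finset.Icc (-M : ℤ) M,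
      if ((4 * a : ℕ) : ℤ) ∣ b ^ 2 - d then 1 else 0 : ℕ) : ℝ) ≤ M / a + 1 := by
    intro b
    rw [← Finset.card_filter]
    have h2 := card_Ico_filter_intCast_eq_le (q := 4 * a) (-M) (2 * M + 1) ((b ^ 2 : ℤ) : ZMod (4 * a))
    have h3 : ((Finset.Ico (-M : ℤ) (-M + (2 * M + 1 : ℕ))).filter
        fun k : ℤ => (k : ZMod (4 * a)) = ((b ^ 2 : ℤ) : ZMod (4 * a))) =
        (Finset.Icc (-M : ℤ) M).filter fun d => ((4 * a : ℕ) : ℤ) ∣ b ^ 2 - d := by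
      ext k
      rw [Finset.mem_filter, Finset.mem_filter, ZMod.intCast_eq_intCast_iff_dvd_sub,
        Finset.mem_Ico, Finset.mem_Icc]
      refine and_congr_left fun _ => ?_
      omega
    rw [h3] at h2
    refine h2.trans ?_
    gcongr ?_ + 1
    push_cast
    rw [div_le_div_iff₀ (by positivity) ha']
    nlinarith
  refine (Finset.sum_le_sum fun b _ => h1 b).trans ?_
  rw [Finset.sum_const, nsmul_eq_mul]
  gcongr
  exact card_abs_sq_sub_le R M (4 * a * R) hM

theorem abs_card_quadPairs_sub_le (R M a : ℕ) (ha : 1 ≤ a) :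
    |((quadPairs R M a).card : ℝ) -
      (sqResiduePairs (Nat.sqrt (min (R ^ 2) (4 * a * R))) M a).card| ≤
        (boundaryPairs R M a).card := by
  classical
  set β := Nat.sqrt (min (R ^ 2) (4 * a * R)) with hβ
  have hβiff : ∀ b : ℤ, b ∈ Finset.Icc (-β : ℤ) β ↔ b ^ 2 ≤ R ^ 2 ∧ b ^ 2 ≤ 4 * (a : ℤ) * R := by
    intro b
    rw [Finset.mem_Icc, ← abs_le, Int.abs_eq_natAbs, Int.ofNat_le, hβ, Nat.le_sqrt', le_min_iff,
      ← Int.natAbs_sq]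
    constructor
    · rintro ⟨h1, h2⟩; exact ⟨by exact_mod_cast h1, by exact_mod_cast h2⟩
    · rintro ⟨h1, h2⟩; exact ⟨by exact_mod_cast h1, by exact_mod_cast h2⟩
  have hRiff : ∀ b : ℤ, b ∈ Finset.Icc (-R : ℤ) R ↔ b ^ 2 ≤ R ^ 2 := by
    intro b
    rw [Finset.mem_Icc, ← abs_le, sq_le_sq, Nat.abs_cast]
  have ha' : (1 : ℤ) ≤ a := by exact_mod_cast ha
  -- The change of variables d = b² - 4ac, injective because a ≠ 0; |c| ≤ R becomes |b² - d| ≤ 4aR.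
  set A := (quadPairs R M a).image fun p : ℤ × ℤ => (p.1, p.1 ^ 2 - 4 * (a : ℤ) * p.2) with hA
  have hAcard : A.card = (quadPairs R M a).card := by
    refine Finset.card_image_of_injective _ fun p p' h => ?_
    simp only [Prod.mk.injEq] at h
    obtain ⟨h1, h2⟩ := h
    rw [h1] at h2
    have h3 : (4 * a : ℤ) * p.2 = 4 * a * p'.2 := by linarith
    exact Prod.ext h1 (mul_left_cancel₀ (by positivity) h3)
  have hAmem : ∀ b d : ℤ, (b, d) ∈ A ↔ b ^ 2 ≤ R ^ 2 ∧ |d| ≤ (M : ℤ) ∧ ((4 * a : ℕ) : ℤ) ∣ b ^ 2 - d ∧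
      |b ^ 2 - d| ≤ 4 * (a : ℤ) * R := by
    intro b d
    simp only [hA, quadPairs, Finset.mem_image, Finset.mem_filter, Finset.mem_product, hRiff,
      Prod.mk.injEq, Prod.exists]
    constructor
    · rintro ⟨b', c, ⟨⟨h1, h2⟩, h3⟩, rfl, rfl⟩
      refine ⟨h1, h3, ⟨c, by push_cast; ring⟩, ?_⟩
      rw [sub_sub_cancel, abs_mul, abs_of_pos (by positivity)]
      gcongr
      rwa [sq_le_sq, Nat.abs_cast] at h2
    · rintro ⟨h1, h2, ⟨c, hc⟩, h4⟩
      push_cast at hc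
      refine ⟨b, c, ⟨⟨h1, ?_⟩, ?_⟩, rfl, by linarith⟩
      · rw [hc, abs_mul, abs_of_pos (by positivity)] at h4
        rw [sq_le_sq, Nat.abs_cast]
        exact le_of_mul_le_mul_left h4 (by positivity)
      · rwa [show b ^ 2 - 4 * a * c = d by linarith]
  have hBmem : ∀ b d : ℤ, (b, d) ∈ sqResiduePairs β M a ↔
      (b ^ 2 ≤ R ^ 2 ∧ b ^ 2 ≤ 4 * a * R) ∧ |d| ≤ (M : ℤ) ∧ ((4 * a : ℕ) : ℤ) ∣ b ^ 2 - d := by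
    intro b d
    rw [sqResiduePairs, Finset.mem_filter, Finset.mem_product, hβiff, Finset.mem_Icc, ← abs_le,
      and_assoc]
  have hEmem : ∀ b d : ℤ, (b, d) ∈ boundaryPairs R M a ↔
      (b ^ 2 ≤ R ^ 2 ∧ |b ^ 2 - 4 * (a : ℤ) * R| ≤ (M : ℤ)) ∧ |d| ≤ (M : ℤ) ∧ ((4 * a : ℕ) : ℤ) ∣ b ^ 2 - d := by
    intro b d
    rw [boundaryPairs, Finset.mem_filter, Finset.mem_product, Finset.mem_filter, hRiff,
      Finset.mem_Icc, ← abs_le, and_assoc]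
  have hAB : A ⊆ sqResiduePairs β M a ∪ boundaryPairs R M a := by
    rintro ⟨b, d⟩ h
    rw [hAmem] at h
    obtain ⟨h1, h2, h3, h4⟩ := h
    rw [Finset.mem_union, hBmem, hEmem]
    by_cases h5 : b ^ 2 ≤ 4 * (a : ℤ) * R
    · exact Or.inl ⟨⟨h1, h5⟩, h2, h3⟩
    -- Here b² exceeds 4aR while b² - d does not, so b² is within |d| ≤ M of 4aR.
    · refine Or.inr ⟨⟨h1, ?_⟩, h2, h3⟩
      rw [abs_le] at h2 h4 ⊢
      constructor <;> linarith
  have hBA : sqResiduePairs β M a ⊆ A ∪ boundaryPairs R M a := by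
    rintro ⟨b, d⟩ h
    rw [hBmem] at h
    obtain ⟨⟨h1, h5⟩, h2, h3⟩ := h
    rw [Finset.mem_union, hAmem, hEmem]
    by_cases h4 : |b ^ 2 - d| ≤ 4 * (a : ℤ) * R
    · exact Or.inl ⟨h1, h2, h3, h4⟩
    · refine Or.inr ⟨⟨h1, ?_⟩, h2, h3⟩
      rw [abs_le] at h2 ⊢
      rw [not_le, lt_abs] at h4
      have h6 : (0 : ℤ) ≤ 4 * a * R := by positivity
      rcases h4 with h4 | h4 <;> constructor <;> nlinarith [sq_nonneg b]
  have h1 := (Finset.card_le_card hAB).trans (Finset.card_union_le _ _)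
  have h2 := (Finset.card_le_card hBA).trans (Finset.card_union_le _ _)
  rw [hAcard] at h1 h2
  have h1' : ((quadPairs R M a).card : ℝ) ≤
      (sqResiduePairs β M a).card + (boundaryPairs R M a).card := by exact_mod_cast h1
  have h2' : ((sqResiduePairs β M a).card : ℝ) ≤
      (quadPairs R M a).card + (boundaryPairs R M a).card := by exact_mod_cast h2
  rw [abs_le]
  constructor <;> linarith

/-! ### The main term -/

theorem antitoneOn_min_div_sqrt (R : ℝ) (hR : 0 ≤ R) :
    AntitoneOn (fun x : ℝ => min (R / x) (2 * √R / √x)) (Set.Ioi 0) := by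
  intro x hx y hy hxy
  have hx' : 0 < x := hx
  have := Real.sqrt_pos.mpr hx'
  exact min_le_min (by gcongr) (by gcongr)

/-- The two branches of the minimum cross at x = R/4: the square-root branch gives 2R - 4√R, the
hyperbolic one R ln 4. -/
theorem integral_min_div_sqrt (R : ℝ) (hR : 4 ≤ R) :
    ∫ x in (1 : ℝ)..R, min (R / x) (2 * √R / √x) = 2 * R - 4 * √R + R * (2 * Real.log 2) := by
  have hanti := antitoneOn_min_div_sqrt R (by linarith)
  have hint : ∀ u v : ℝ, 0 < u → u ≤ v →
      IntervalIntegrable (fun x : ℝ => min (R / x) (2 * √R / √x)) MeasureTheory.volume u v := by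
    intro u v hu huv
    refine AntitoneOn.intervalIntegrable (hanti.mono ?_)
    rw [Set.uIcc_of_le huv]
    exact fun x hx => lt_of_lt_of_le hu hx.1
  have hR0 : 0 < R := by linarith
  rw [← intervalIntegral.integral_add_adjacent_intervals (hint 1 (R / 4) one_pos (by linarith))
    (hint (R / 4) R (by linarith) (by linarith))]
  have hs : √(R / 4) = √R / 2 := by
    rw [Real.sqrt_div hR0.le, show (4 : ℝ) = 2 ^ 2 by norm_num, Real.sqrt_sq (by norm_num)]
  have hsR : √R * √R = R := Real.mul_self_sqrt hR0.le
  have h1 : ∫ x in (1 : ℝ)..(R / 4), min (R / x) (2 * √R / √x) = 2 * R - 4 * √R := by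
    have : ∫ x in (1 : ℝ)..(R / 4), min (R / x) (2 * √R / √x) =
        ∫ x in (1 : ℝ)..(R / 4), 2 * √R * x ^ (-(1 / 2) : ℝ) := by
      refine intervalIntegral.integral_congr fun x hx => ?_
      rw [Set.uIcc_of_le (by linarith)] at hx
      have hx0 : 0 < x := by linarith [hx.1]
      have hsx := Real.sqrt_pos.mpr hx0
      have hsxx : √x * √x = x := Real.mul_self_sqrt hx0.le
      have hle : √x ≤ √R / 2 := by rw [← hs]; exact Real.sqrt_le_sqrt hx.2
      rw [min_eq_right, Real.rpow_neg hx0.le, ← Real.sqrt_eq_rpow, div_eq_mul_inv]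
      rw [div_le_div_iff₀ hsx hx0]
      nlinarith [mul_nonneg (mul_nonneg hsx.le (Real.sqrt_nonneg R)) (sub_nonneg.mpr hle)]
    rw [this, intervalIntegral.integral_const_mul, integral_rpow (Or.inl (by norm_num))]
    rw [show (-(1 / 2) + 1 : ℝ) = 1 / 2 by norm_num, ← Real.sqrt_eq_rpow, hs, Real.one_rpow]
    linear_combination 2 * hsR
  have h2 : ∫ x in (R / 4)..R, min (R / x) (2 * √R / √x) = R * (2 * Real.log 2) := by
    have : ∫ x in (R / 4)..R, min (R / x) (2 * √R / √x) = ∫ x in (R / 4)..R, R * (1 / x) := by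
      refine intervalIntegral.integral_congr fun x hx => ?_
      rw [Set.uIcc_of_le (by linarith)] at hx
      have hx0 : 0 < x := by linarith [hx.1]
      have hsx := Real.sqrt_pos.mpr hx0
      have hsxx : √x * √x = x := Real.mul_self_sqrt hx0.le
      have hle : √R / 2 ≤ √x := by rw [← hs]; exact Real.sqrt_le_sqrt hx.1
      rw [min_eq_left, mul_one_div]
      rw [div_le_div_iff₀ hx0 hsx]
      nlinarith [mul_nonneg (mul_nonneg hsx.le (Real.sqrt_nonneg R)) (sub_nonneg.mpr hle)]
    rw [this, intervalIntegral.integral_const_mul,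
      integral_one_div_of_pos (by linarith) hR0]
    congr 1
    rw [show R / (R / 4) = 2 ^ 2 by field_simp; norm_num, Real.log_pow]
    norm_num
  rw [h1, h2]

theorem abs_sum_min_div_sqrt_sub_le (R : ℕ) (hR : 1 ≤ R) :
    |∑ a ∈ Finset.Icc 1 R, min (R / a : ℝ) (2 * √(R : ℝ) / √(a : ℝ)) -
      2 * R * (Real.log 2 + 1)| ≤ 12 * √(R : ℝ) := by
  have hR' : (1 : ℝ) ≤ R := by exact_mod_cast hR
  have hsR : 1 ≤ √(R : ℝ) := Real.one_le_sqrt.mpr hR'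
  have hsRR : √(R : ℝ) * √(R : ℝ) = R := Real.mul_self_sqrt (by positivity)
  have hl := Real.log_two_lt_d9
  have hl0 := Real.log_two_gt_d9
  rcases lt_or_ge R 4 with h4 | h4
  -- For R < 4 the crossing point R/4 lies to the left of 1; both quantities are then bounded
  -- outright, within 12.
  · have hR3 : (R : ℝ) ≤ 3 := by exact_mod_cast (by omega : R ≤ 3)
    have h0 : 0 ≤ ∑ a ∈ Finset.Icc 1 R, min (R / a : ℝ) (2 * √(R : ℝ) / √(a : ℝ)) :=
      Finset.sum_nonneg fun a _ => by positivity
    have h1 : ∑ a ∈ Finset.Icc 1 R, min (R / a : ℝ) (2 * √(R : ℝ) / √(a : ℝ)) ≤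
        ∑ a ∈ Finset.Icc 1 R, (3 : ℝ) := by
      refine Finset.sum_le_sum fun a ha => (min_le_left _ _).trans ?_
      rw [Finset.mem_Icc] at ha
      have : (1 : ℝ) ≤ a := by exact_mod_cast ha.1
      rw [div_le_iff₀ (by linarith)]
      linarith
    rw [Finset.sum_const, Nat.card_Icc, nsmul_eq_mul, Nat.add_sub_cancel] at h1
    rw [abs_le]
    constructor <;> nlinarith
  · have hR4 : (4 : ℝ) ≤ R := by exact_mod_cast h4
    set g : ℝ → ℝ := fun x => min (R / x : ℝ) (2 * √(R : ℝ) / √x) with hg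
    have hanti : AntitoneOn g (Set.Icc ((1 : ℕ) : ℝ) (R : ℝ)) :=
      (antitoneOn_min_div_sqrt R (by linarith)).mono fun x hx => by
        have := hx.1
        simp only [Nat.cast_one] at this
        exact lt_of_lt_of_le one_pos this
    have h1 := hanti.sum_le_integral_Ico hR
    have h2 := hanti.integral_le_sum_Ico hR
    have h3 := integral_min_div_sqrt R hR4
    rw [Nat.cast_one] at h1 h2
    rw [h3] at h1 h2
    have hg1 : g 1 ≤ 2 * √(R : ℝ) := by
      simp only [hg]
      exact (min_le_right _ _).trans (by simp)
    have hgR : 0 ≤ g R := by simp only [hg]; positivity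
    have e1 : ∑ a ∈ Finset.Icc 1 R, g (a : ℝ) = ∑ a ∈ Finset.Ico 1 R, g (a : ℝ) + g R := by
      rw [← Finset.Ico_add_one_right_eq_Icc, Finset.sum_Ico_succ_top hR]
    have e2 : ∑ a ∈ Finset.Icc 1 R, g (a : ℝ) =
        g 1 + ∑ a ∈ Finset.Ico 1 R, g ((a + 1 : ℕ) : ℝ) := by
      rw [← Finset.Ico_add_one_right_eq_Icc, Finset.sum_eq_sum_Ico_succ_bot (by omega),
        Finset.sum_Ico_add' (fun a : ℕ => g (a : ℝ)) 1 R 1]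
      simp
    change |∑ a ∈ Finset.Icc 1 R, g (a : ℝ) - _| ≤ _
    rw [abs_le]
    constructor
    · rw [e1]; linarith
    · rw [e2]; linarith

/-! ### Summation over the leading coefficient -/

/-- The triples `(a, b, c)` with `a ≠ 0` and entries at most `R` in absolute value, for which
`|b ^ 2 - 4 * a * c| ≤ M`. -/
noncomputable def quadTriples (R M : ℕ) : Finset (ℤ × ℤ × ℤ) :=
  (Finset.Icc (-R : ℤ) R ×ˢ Finset.Icc (-R : ℤ) R ×ˢ Finset.Icc (-R : ℤ) R).filter
    fun t : ℤ × ℤ × ℤ => t.1 ≠ 0 ∧ |t.2.1 ^ 2 - 4 * t.1 * t.2.2| ≤ (M : ℤ)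

theorem sum_Icc_neg_ne_zero {G : Type*} [AddCommMonoid G] (f : ℤ → G) (R : ℕ) :
    ∑ a ∈ Finset.Icc (-R : ℤ) R with a ≠ 0, f a = ∑ a ∈ Finset.Icc 1 R, (f a + f (-a)) := by
  induction R with
  | zero => simp [Finset.filter_singleton]
  | succ n ih =>
    rw [Finset.sum_Icc_succ_top (by omega), ← ih]
    have h : (Finset.Icc (-(n + 1 : ℕ) : ℤ) (n + 1 : ℕ)).filter (fun a => a ≠ 0) =
        insert ((n + 1 : ℕ) : ℤ) (insert (-((n + 1 : ℕ) : ℤ))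
          ((Finset.Icc (-n : ℤ) n).filter fun a => a ≠ 0)) := by
      ext a
      simp only [Finset.mem_filter, Finset.mem_insert, Finset.mem_Icc]
      omega
    rw [h, Finset.sum_insert, Finset.sum_insert]
    · rw [← add_assoc, add_comm]
    · simp only [Finset.mem_filter, Finset.mem_Icc]; omega
    · simp only [Finset.mem_insert, Finset.mem_filter, Finset.mem_Icc]; omega

theorem card_quadTriples (R M : ℕ) :
    (quadTriples R M).card = 2 * ∑ a ∈ Finset.Icc 1 R, (quadPairs R M a).card := by
  have h1 : (quadTriples R M).card =
      ∑ a ∈ Finset.Icc (-R : ℤ) R with a ≠ 0, (quadPairs R M a).card := by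
    rw [quadTriples, Finset.card_filter, Finset.sum_product, Finset.sum_filter]
    refine Finset.sum_congr rfl fun a _ => ?_
    rw [quadPairs, Finset.card_filter]
    by_cases ha : a = 0 <;> simp [ha]
  rw [h1, sum_Icc_neg_ne_zero, Finset.mul_sum]
  refine Finset.sum_congr rfl fun a _ => ?_
  rw [card_quadPairs_neg]
  ring

/-- Absorbs the mixed errors R√M and M√R into the two pure ones. -/
theorem mul_sqrt_le_add {x y : ℝ} (hx : 0 ≤ x) (hy : 0 ≤ y) : x * √y ≤ x * √x + y * √y := by
  rcases le_total x y with h | h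
  · have : x * √y ≤ y * √y := by gcongr
    have : 0 ≤ x * √x := by positivity
    linarith
  · have : x * √y ≤ x * √x := by gcongr
    have : 0 ≤ y * √y := by positivity
    linarith

/-- The main term of the number of pairs attached to a single leading coefficient. -/
theorem abs_mainTerm_sub_le (R M a : ℕ) (ha : 1 ≤ a) (hR : 1 ≤ R) (hM : 1 ≤ M) :
    |(2 * (Nat.sqrt (min (R ^ 2) (4 * a * R)) : ℝ) + 1) * (2 * M + 1) / (4 * a) -
      M * min (R / a : ℝ) (2 * √(R : ℝ) / √(a : ℝ))| ≤ (M + R) * (1 / a) := by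
  have ha' : (0 : ℝ) < a := by exact_mod_cast ha
  have hM' : (1 : ℝ) ≤ M := by exact_mod_cast hM
  have hR' : (1 : ℝ) ≤ R := by exact_mod_cast hR
  set B : ℝ := √((min (R ^ 2) (4 * a * R) : ℕ) : ℝ) with hB
  set β := Nat.sqrt (min (R ^ 2) (4 * a * R)) with hβ
  have h1 : (β : ℝ) ≤ B := Real.nat_sqrt_le_real_sqrt
  have h2 : B < β + 1 := Real.real_sqrt_lt_nat_sqrt_succ
  have hsa := Real.sqrt_pos.mpr ha'
  have hsaa : √(a : ℝ) * √(a : ℝ) = a := Real.mul_self_sqrt ha'.le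
  have hBmin : B = min (R : ℝ) (2 * √(R : ℝ) * √(a : ℝ)) := by
    rw [hB]
    push_cast
    rw [Real.sqrt_monotone.map_min, Real.sqrt_sq (by positivity)]
    congr 1
    rw [show (4 * a * R : ℝ) = 2 ^ 2 * R * a by ring, Real.sqrt_mul (by positivity),
      Real.sqrt_mul (by positivity), Real.sqrt_sq (by norm_num)]
  have hBa : min (R / a : ℝ) (2 * √(R : ℝ) / √(a : ℝ)) = B / a := by
    rw [hBmin, ← min_div_div_right ha'.le]
    congr 1
    rw [div_eq_div_iff hsa.ne' ha'.ne']
    linear_combination (-2 * √(R : ℝ)) * hsaa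
  have hBR : B ≤ R := by rw [hBmin]; exact min_le_left _ _
  have hB0 : 0 ≤ B := Real.sqrt_nonneg _
  rw [hBa]
  -- Since β = ⌊B⌋, the quantity 2β + 1 is within 1 of 2B, and B ≤ R controls the rest.
  have e : (2 * (β : ℝ) + 1) * (2 * M + 1) / (4 * a) - M * (B / a) =
      ((2 * (β : ℝ) + 1 - 2 * B) * (2 * M + 1) + 2 * B) / 4 * (1 / a) := by
    field_simp
    ring
  rw [e, abs_mul, abs_of_pos (by positivity : (0 : ℝ) < 1 / a)]
  gcongr
  rw [abs_le]
  constructor <;> nlinarith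

theorem exists_abs_card_quadTriples_sub_le : ∃ C : ℝ, 0 < C ∧ ∀ R M : ℕ, 1 ≤ R → 1 ≤ M →
    |((quadTriples R M).card : ℝ) - 4 * (Real.log 2 + 1) * R * M| ≤
      C * (M * √(M : ℝ) * (1 + Real.log (4 * R)) +
        R * (1 + Real.log (4 * R)) * √(R * (1 + Real.log (4 * R)))) := by
  obtain ⟨C, hC, hE⟩ := exists_sum_abs_card_sq_sub_le
  refine ⟨2 * C + 200, by positivity, fun R M hR hM => ?_⟩
  have hM' : (1 : ℝ) ≤ M := by exact_mod_cast hM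
  have hR' : (1 : ℝ) ≤ R := by exact_mod_cast hR
  have hlog0 : 0 ≤ Real.log R := Real.log_nonneg hR'
  have hlog : Real.log R ≤ Real.log (4 * R) := by gcongr; linarith
  set L := 1 + Real.log (4 * R) with hL
  have hL1 : 1 ≤ L := by linarith
  let β : ℕ → ℕ := fun a => Nat.sqrt (min (R ^ 2) (4 * a * R))
  have hβ : ∀ a, β a ≤ R := fun a => by
    have : Nat.sqrt (min (R ^ 2) (4 * a * R)) ≤ Nat.sqrt (R ^ 2) := Nat.sqrt_le_sqrt (min_le_left _ _)
    rwa [Nat.sqrt_eq'] at this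
  let t : ℕ → ℝ := fun a => (quadPairs R M a).card
  let m : ℕ → ℝ := fun a => (sqResiduePairs (β a) M a).card
  let u : ℕ → ℝ := fun a => (2 * β a + 1) * (2 * M + 1) / (4 * a)
  let w : ℕ → ℝ := fun a => min (R / a : ℝ) (2 * √(R : ℝ) / √(a : ℝ))
  have hT : ((quadTriples R M).card : ℝ) = 2 * ∑ a ∈ Finset.Icc 1 R, t a := by
    rw [card_quadTriples]; push_cast; rfl
  have hinv : ∑ a ∈ Finset.Icc 1 R, (1 / a : ℝ) ≤ L := (sum_inv_Icc_le R).trans (by linarith)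
  have h1 : ∑ a ∈ Finset.Icc 1 R, |t a - m a| ≤ 5 * (M * √(M : ℝ) * L) + 5 * (R * √(M : ℝ)) := by
    calc _ ≤ ∑ a ∈ Finset.Icc 1 R, (5 * (M * √(M : ℝ)) * (1 / a : ℝ) + 5 * √(M : ℝ)) := by
          refine Finset.sum_le_sum fun a ha => ?_
          rw [Finset.mem_Icc] at ha
          refine (abs_card_quadPairs_sub_le R M a ha.1).trans
            ((card_boundaryPairs_le R M a ha.1 hM).trans (le_of_eq ?_))
          ring
      _ = 5 * (M * √(M : ℝ)) * ∑ a ∈ Finset.Icc 1 R, (1 / a : ℝ) + R * (5 * √(M : ℝ)) := by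
          rw [Finset.sum_add_distrib, Finset.sum_const, Nat.card_Icc, nsmul_eq_mul,
            Nat.add_sub_cancel, Finset.mul_sum]
      _ ≤ 5 * (M * √(M : ℝ)) * L + R * (5 * √(M : ℝ)) := by gcongr
      _ = _ := by ring
  have h2 : ∑ a ∈ Finset.Icc 1 R, |m a - u a| ≤ C * (R * L * √(R * L)) := hE R M β hβ
  have h3 : ∑ a ∈ Finset.Icc 1 R, |u a - M * w a| ≤ (M + R) * L := by
    calc _ ≤ ∑ a ∈ Finset.Icc 1 R, (M + R : ℝ) * (1 / a) := by
          refine Finset.sum_le_sum fun a ha => ?_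
          rw [Finset.mem_Icc] at ha
          exact abs_mainTerm_sub_le R M a ha.1 hR hM
      _ = (M + R : ℝ) * ∑ a ∈ Finset.Icc 1 R, (1 / a : ℝ) := by rw [Finset.mul_sum]
      _ ≤ _ := by gcongr
  have h4 : |∑ a ∈ Finset.Icc 1 R, w a - 2 * R * (Real.log 2 + 1)| ≤ 12 * √(R : ℝ) :=
    abs_sum_min_div_sqrt_sub_le R hR
  -- Telescoping from the true count t through the congruence count m and its expected value u to
  -- the smooth term M·w; the leading 2 accounts for the sign of a.
  have e : ((quadTriples R M).card : ℝ) - 4 * (Real.log 2 + 1) * R * M =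
      2 * (∑ a ∈ Finset.Icc 1 R, ((t a - m a) + (m a - u a) + (u a - M * w a))) +
        2 * M * (∑ a ∈ Finset.Icc 1 R, w a - 2 * R * (Real.log 2 + 1)) := by
    have : ∑ a ∈ Finset.Icc 1 R, ((t a - m a) + (m a - u a) + (u a - M * w a)) =
        ∑ a ∈ Finset.Icc 1 R, t a - M * ∑ a ∈ Finset.Icc 1 R, w a := by
      rw [Finset.mul_sum, ← Finset.sum_sub_distrib]
      exact Finset.sum_congr rfl fun a _ => by ring
    rw [this, hT]
    ring
  have h5 : |∑ a ∈ Finset.Icc 1 R, ((t a - m a) + (m a - u a) + (u a - M * w a))| ≤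
      ∑ a ∈ Finset.Icc 1 R, |t a - m a| + ∑ a ∈ Finset.Icc 1 R, |m a - u a| +
        ∑ a ∈ Finset.Icc 1 R, |u a - M * w a| := by
    rw [← Finset.sum_add_distrib, ← Finset.sum_add_distrib]
    exact (Finset.abs_sum_le_sum_abs _ _).trans (Finset.sum_le_sum fun a _ => abs_add_three _ _ _)
  have h6 : |((quadTriples R M).card : ℝ) - 4 * (Real.log 2 + 1) * R * M| ≤
      2 * |∑ a ∈ Finset.Icc 1 R, ((t a - m a) + (m a - u a) + (u a - M * w a))| +
        2 * M * |∑ a ∈ Finset.Icc 1 R, w a - 2 * R * (Real.log 2 + 1)| := by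
    rw [e]
    refine (abs_add_le _ _).trans (le_of_eq ?_)
    rw [abs_mul, abs_mul, abs_of_pos (two_pos : (0 : ℝ) < 2),
      abs_of_pos (by positivity : (0 : ℝ) < 2 * M)]
  set X := M * √(M : ℝ) * L with hX
  set Y := R * L * √(R * L) with hY
  have hsM : 1 ≤ √(M : ℝ) := Real.one_le_sqrt.mpr hM'
  have hRL : (R : ℝ) ≤ R * L := le_mul_of_one_le_right (by positivity) hL1
  have hsR : √(R : ℝ) ≤ √(R * L) := Real.sqrt_le_sqrt hRL
  have hsRL : 1 ≤ √(R * L) := Real.one_le_sqrt.mpr (hR'.trans hRL)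
  have hMX : M * √(M : ℝ) ≤ X := le_mul_of_one_le_right (by positivity) hL1
  have hRY : R * √(R : ℝ) ≤ Y := by rw [hY]; gcongr
  have b1 : R * √(M : ℝ) ≤ X + Y := by
    linarith [mul_sqrt_le_add (x := (R : ℝ)) (y := M) (by positivity) (by positivity)]
  have b2 : M * √(R : ℝ) ≤ X + Y := by
    linarith [mul_sqrt_le_add (x := (M : ℝ)) (y := R) (by positivity) (by positivity)]
  have b3 : M * L ≤ X := by
    rw [hX]; gcongr; exact le_mul_of_one_le_right (by positivity) hsM
  have b4 : R * L ≤ Y := le_mul_of_one_le_right (by positivity) hsRL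
  have hM4 : 2 * (M : ℝ) * |∑ a ∈ Finset.Icc 1 R, w a - 2 * R * (Real.log 2 + 1)| ≤
      2 * M * (12 * √(R : ℝ)) := by gcongr
  have hX0 : 0 ≤ X := by positivity
  have hY0 : 0 ≤ Y := by positivity
  have hCX : 0 ≤ C * X := by positivity
  nlinarith

/-! ### Polynomials as coefficient triples -/

theorem polyHeight_le_iff {p : ℤ[X]} {n : ℕ} :
    polyHeight p ≤ n ↔ ∀ i, |p.coeff i| ≤ (n : ℤ) := by
  rw [polyHeight, Finset.sup_le_iff]
  constructor
  · intro h i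
    by_cases hi : p.coeff i = 0
    · simp [hi]
    · have := h i (mem_support_iff.mpr hi)
      rw [Int.abs_eq_natAbs]
      exact_mod_cast this
  · intro h i _
    have := h i
    rw [Int.abs_eq_natAbs] at this
    exact_mod_cast this

theorem polyHeight_cast_le_iff {p : ℤ[X]} {Q : ℝ} (hQ : 0 ≤ Q) :
    (polyHeight p : ℝ) ≤ Q ↔ ∀ i, |p.coeff i| ≤ (⌊Q⌋₊ : ℤ) := by
  rw [← polyHeight_le_iff, Nat.le_floor_iff hQ]

theorem abs_intCast_le_iff_floor {z : ℤ} {D : ℝ} (hD : 0 ≤ D) :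
    |(z : ℝ)| ≤ D ↔ |z| ≤ (⌊D⌋₊ : ℤ) := by
  rw [Int.abs_eq_natAbs, Int.ofNat_le, Nat.le_floor_iff hD, Nat.cast_natAbs, Int.cast_abs]

theorem quadCount_eq_card {Q D : ℝ} (hQ : 0 ≤ Q) (hD : 0 ≤ D) :
    quadCount Q D = (quadTriples ⌊Q⌋₊ ⌊D⌋₊).card := by
  let f : ℤ × ℤ × ℤ → ℤ[X] := fun t => C t.1 * X ^ 2 + C t.2.1 * X + C t.2.2
  have hc0 : ∀ t, (f t).coeff 0 = t.2.2 := fun t => by simp [f]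
  have hc1 : ∀ t, (f t).coeff 1 = t.2.1 := fun t => by simp [f, -eq_intCast, coeff_C]
  have hc2 : ∀ t, (f t).coeff 2 = t.1 := fun t => by simp [f, -eq_intCast]
  have hf : Function.Injective f := by
    intro t t' h
    refine Prod.ext ?_ (Prod.ext ?_ ?_)
    · rw [← hc2, ← hc2, h]
    · rw [← hc1, ← hc1, h]
    · rw [← hc0, ← hc0, h]
  have hset : {p : ℤ[X] | p ∈ polysOfHeightLE 2 Q ∧ |(p.discr : ℝ)| ≤ D} =
      f '' (quadTriples ⌊Q⌋₊ ⌊D⌋₊ : Set (ℤ × ℤ × ℤ)) := by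
    ext p
    simp only [polysOfHeightLE, Set.mem_ofPred_eq, Set.mem_image, Finset.mem_coe, quadTriples,
      Finset.mem_filter, Finset.mem_product, Finset.mem_Icc, ← abs_le]
    rw [polyHeight_cast_le_iff hQ, abs_intCast_le_iff_floor hD]
    constructor
    · rintro ⟨⟨hdeg, hh⟩, hd⟩
      have hdeg' : p.degree = 2 := hdeg
      refine ⟨(p.coeff 2, p.coeff 1, p.coeff 0), ⟨⟨hh 2, hh 1, hh 0⟩, ?_, ?_⟩, ?_⟩
      · exact coeff_ne_zero_of_eq_degree hdeg
      · rw [discr_of_degree_eq_two hdeg'] at hd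
        rwa [mul_right_comm] at hd
      · exact (eq_quadratic_of_degree_le_two hdeg'.le).symm
    · rintro ⟨t, ⟨⟨h2, h1, h0⟩, hne, hd⟩, rfl⟩
      have hdeg : (f t).degree = 2 := degree_quadratic hne
      refine ⟨⟨hdeg, fun i => ?_⟩, ?_⟩
      · rcases lt_or_ge 2 i with hi | hi
        · rw [coeff_eq_zero_of_degree_lt (by rw [hdeg]; exact_mod_cast hi)]
          simp
        · interval_cases i
          · rwa [hc0]
          · rwa [hc1]
          · rwa [hc2]
      · rw [discr_of_degree_eq_two hdeg, hc0, hc1, hc2, mul_right_comm]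
        exact hd
  rw [quadCount, hset, Set.ncard_image_of_injective _ hf, Set.ncard_coe_finset]

theorem discrGamma_two : discrGamma 2 = 5 := by
  refine IsGreatest.csSup_eq ⟨?_, ?_⟩
  -- The extremal polynomial is x² + x - 1, of height 1 and discriminant 5.
  · refine ⟨C 1 * X ^ 2 + C 1 * X + C (-1), degree_quadratic one_ne_zero, ?_⟩
    have hdeg : (C 1 * X ^ 2 + C 1 * X + C (-1) : ℤ[X]).degree = 2 := degree_quadratic one_ne_zero
    have hc0 : (C 1 * X ^ 2 + C 1 * X + C (-1) : ℤ[X]).coeff 0 = -1 := by simp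
    have hc1 : (C 1 * X ^ 2 + C 1 * X + C (-1) : ℤ[X]).coeff 1 = 1 := by simp [coeff_X, coeff_one]
    have hc2 : (C 1 * X ^ 2 + C 1 * X + C (-1) : ℤ[X]).coeff 2 = 1 := by simp [coeff_X, coeff_one]
    set p : ℤ[X] := C 1 * X ^ 2 + C 1 * X + C (-1)
    have hH : polyHeight p = 1 := by
      refine le_antisymm (polyHeight_le_iff.mpr fun i => ?_) ?_
      · rcases lt_or_ge 2 i with hi | hi
        · rw [coeff_eq_zero_of_degree_lt (by rw [hdeg]; exact_mod_cast hi)]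
          simp
        · interval_cases i
          · rw [hc0]; norm_num
          · rw [hc1]; norm_num
          · rw [hc2]; norm_num
      · have := polyHeight_le_iff.mp (le_refl (polyHeight p)) 2
        rw [hc2] at this
        simpa using this
    rw [discr_of_degree_eq_two hdeg, hc0, hc1, hc2, hH]
    norm_num
  · rintro _ ⟨p, hdeg, rfl⟩
    have hdeg' : p.degree = 2 := hdeg
    have h := polyHeight_le_iff.mp (le_refl (polyHeight p))
    refine div_le_of_le_mul₀ (by positivity) (by norm_num) ?_
    rw [discr_of_degree_eq_two hdeg']
    have key : |p.coeff 1 ^ 2 - 4 * p.coeff 0 * p.coeff 2| ≤ 5 * (polyHeight p : ℤ) ^ 2 := by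
      refine (abs_sub _ _).trans ?_
      rw [abs_pow, abs_mul, abs_mul]
      have h0 := h 0
      have h1 := h 1
      have h2 := h 2
      calc |p.coeff 1| ^ 2 + |(4 : ℤ)| * |p.coeff 0| * |p.coeff 2|
          ≤ (polyHeight p : ℤ) ^ 2 + 4 * polyHeight p * polyHeight p := by
            rw [show |(4 : ℤ)| = 4 by norm_num]
            gcongr
        _ = _ := by ring
    exact_mod_cast key

theorem ncard_polysOfSmallDiscr_two (Q v : ℝ) :
    (polysOfSmallDiscr 2 Q v).ncard = quadCount Q (5 * Q ^ (2 - 2 * v)) := by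
  rw [polysOfSmallDiscr, quadCount, discrGamma_two]
  norm_num

/-! ### The asymptotic formula and the order of magnitude -/

theorem rpow_three_halves {x : ℝ} (hx : 0 ≤ x) : x ^ (3 / 2 : ℝ) = x * √x := by
  rcases hx.eq_or_lt with rfl | h
  · rw [Real.zero_rpow (by norm_num)]; simp
  · rw [show (3 / 2 : ℝ) = 1 + 1 / 2 by norm_num, Real.rpow_add h, Real.rpow_one,
      Real.sqrt_eq_rpow]

theorem exists_abs_quadCount_sub_le : ∃ C : ℝ, 0 < C ∧ ∀ Q D : ℝ, 1 < Q → 1 ≤ D → D ≤ Q ^ 2 / 2 →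
    |(quadCount Q D : ℝ) - 4 * (Real.log 2 + 1) * Q * D| ≤
      C * (D ^ (3 / 2 : ℝ) * Real.log Q + (Q * Real.log Q) ^ (3 / 2 : ℝ)) := by
  obtain ⟨C, hC, hmain⟩ := exists_abs_card_quadTriples_sub_le
  refine ⟨24 * C + 48, by positivity, fun Q D hQ hD hDQ => ?_⟩
  have hQ0 : 0 ≤ Q := by linarith
  have hD0 : 0 ≤ D := by linarith
  rw [quadCount_eq_card hQ0 hD0]
  have hR : 1 ≤ ⌊Q⌋₊ := Nat.le_floor (by simpa using hQ.le)
  have hM : 1 ≤ ⌊D⌋₊ := Nat.le_floor (by simpa using hD)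
  have h1 := hmain _ _ hR hM
  have hRQ : (⌊Q⌋₊ : ℝ) ≤ Q := Nat.floor_le hQ0
  have hMD : (⌊D⌋₊ : ℝ) ≤ D := Nat.floor_le hD0
  have hRQ' : Q < ⌊Q⌋₊ + 1 := Nat.lt_floor_add_one Q
  have hMD' : D < ⌊D⌋₊ + 1 := Nat.lt_floor_add_one D
  have hR1 : (1 : ℝ) ≤ ⌊Q⌋₊ := by exact_mod_cast hR
  have hM1 : (1 : ℝ) ≤ ⌊D⌋₊ := by exact_mod_cast hM
  generalize ((quadTriples ⌊Q⌋₊ ⌊D⌋₊).card : ℝ) = N at *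
  generalize (⌊Q⌋₊ : ℝ) = R at *
  generalize (⌊D⌋₊ : ℝ) = M at *
  have hl := Real.log_two_lt_d9
  have hl0 := Real.log_two_gt_d9
  -- The constraints 1 ≤ D ≤ Q²/2 force Q² ≥ 2. Thus ln Q is bounded below, and additive constants,
  -- the factor 4 in ln 4R and the rounding errors can be absorbed.
  have hlogQ : Real.log 2 / 2 ≤ Real.log Q := by
    have h2 : Real.log 2 ≤ Real.log (Q ^ 2) := Real.log_le_log two_pos (by linarith)
    rw [Real.log_pow] at h2
    push_cast at h2
    linarith
  set ℓ := Real.log Q with hℓ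
  have hℓ0 : 1 / 3 ≤ ℓ := by linarith
  have hL0 : 0 ≤ 1 + Real.log (4 * R) := by
    have := Real.log_nonneg (show (1 : ℝ) ≤ 4 * R by linarith)
    linarith
  have hL : 1 + Real.log (4 * R) ≤ 8 * ℓ := by
    have h2 : Real.log (4 * R) ≤ Real.log (4 * Q) := by gcongr
    have h3 : Real.log (4 * Q) = 2 * Real.log 2 + ℓ := by
      rw [Real.log_mul (by norm_num) (by linarith), show (4 : ℝ) = 2 ^ 2 by norm_num, Real.log_pow]
      push_cast
      rfl
    linarith
  generalize 1 + Real.log (4 * R) = L at *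
  rw [rpow_three_halves hD0, rpow_three_halves (by positivity)]
  set X := D * √D * ℓ with hX
  set Y := Q * ℓ * √(Q * ℓ) with hY
  have hX0 : 0 ≤ X := by positivity
  have hY0 : 0 ≤ Y := by positivity
  have b1 : M * √M * L ≤ 8 * X := by
    calc M * √M * L ≤ D * √D * (8 * ℓ) := by gcongr
      _ = _ := by rw [hX]; ring
  have b2 : R * L * √(R * L) ≤ 24 * Y := by
    calc R * L * √(R * L) ≤ Q * (8 * ℓ) * √(Q * (8 * ℓ)) := by gcongr
      _ ≤ Q * (8 * ℓ) * (3 * √(Q * ℓ)) := by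
        gcongr
        rw [Real.sqrt_le_left (by positivity), mul_pow, Real.sq_sqrt (by positivity)]
        have : 0 ≤ Q * ℓ := by positivity
        linarith
      _ = _ := by rw [hY]; ring
  have hsD : 1 ≤ √D := Real.one_le_sqrt.mpr hD
  have b3 : D ≤ 3 * X := by
    calc D ≤ D * √D := le_mul_of_one_le_right hD0 hsD
      _ ≤ D * √D * (3 * ℓ) := le_mul_of_one_le_right (by positivity) (by linarith)
      _ = _ := by rw [hX]; ring
  have hQℓ : 1 / 2 ≤ √(Q * ℓ) := by
    refine Real.le_sqrt_of_sq_le ?_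
    nlinarith
  have b4 : Q ≤ 6 * Y := by
    calc Q ≤ Q * (3 * ℓ) := le_mul_of_one_le_right hQ0 (by linarith)
      _ ≤ Q * (3 * ℓ) * (2 * √(Q * ℓ)) := le_mul_of_one_le_right (by positivity) (by linarith)
      _ = _ := by rw [hY]; ring
  -- Replacing Q and D by their integer parts changes the product by at most Q + D, and 4(ln 2 + 1)
  -- < 8.
  have b5 : |4 * (Real.log 2 + 1) * R * M - 4 * (Real.log 2 + 1) * Q * D| ≤ 8 * (Q + D) := by
    have e : 4 * (Real.log 2 + 1) * R * M - 4 * (Real.log 2 + 1) * Q * D =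
        -(4 * (Real.log 2 + 1) * (Q * (D - M) + M * (Q - R))) := by ring
    have h3 : 0 ≤ Q * (D - M) + M * (Q - R) := by
      have := mul_nonneg hQ0 (sub_nonneg.mpr hMD)
      have := mul_nonneg (by linarith : 0 ≤ M) (sub_nonneg.mpr hRQ)
      linarith
    have h4 : Q * (D - M) + M * (Q - R) ≤ Q + D := by nlinarith
    rw [e, abs_neg, abs_of_nonneg (by positivity)]
    calc 4 * (Real.log 2 + 1) * (Q * (D - M) + M * (Q - R))
        ≤ 8 * (Q * (D - M) + M * (Q - R)) := by gcongr; linarith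
      _ ≤ _ := by gcongr
  have b6 := abs_sub_le N (4 * (Real.log 2 + 1) * R * M) (4 * (Real.log 2 + 1) * Q * D)
  have b7 : C * (M * √M * L + R * L * √(R * L)) ≤ C * (8 * X + 24 * Y) := by gcongr
  have b8 : 0 ≤ C * X := by positivity
  nlinarith

theorem ncard_polysOfSmallDiscr_bounds {v : ℝ} (hv : 0 < v) (hv' : v < 3 / 4) :
    ∃ c₁ c₂ : ℝ, 0 < c₁ ∧ 0 < c₂ ∧ ∀ Q : ℝ, 1 < Q →
      c₁ * Q ^ (3 - 2 * v) ≤ ((polysOfSmallDiscr 2 Q v).ncard : ℝ) ∧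
      ((polysOfSmallDiscr 2 Q v).ncard : ℝ) ≤ c₂ * Q ^ (3 - 2 * v) := by
  obtain ⟨C, hC, hmain⟩ := exists_abs_quadCount_sub_le
  have hK : (0 : ℝ) < 5 ^ (3 / 2 : ℝ) := by positivity
  have e1 := (isLittleO_log_rpow_atTop hv).bound (show 0 < 1 / (C * 5 ^ (3 / 2 : ℝ)) by positivity)
  have e2 := (isLittleO_log_rpow_rpow_atTop (3 / 2) (show 0 < 3 / 2 - 2 * v by linarith)).bound
    (show 0 < 1 / C by positivity)
  have e3 := (tendsto_rpow_atTop (show 0 < 2 * v by linarith)).eventually_ge_atTop 10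
  obtain ⟨Q₀, hQ₀⟩ := Filter.eventually_atTop.mp (e1.and (e2.and e3))
  have hl0 := Real.log_two_gt_d9
  have hl := Real.log_two_lt_d9
  set Q₁ := max Q₀ 1 with hQ₁
  have hQ₁1 : 1 ≤ Q₁ := le_max_right _ _
  have hlarge : ∀ Q : ℝ, 1 < Q → Q₁ ≤ Q →
      Q ^ (3 - 2 * v) ≤ ((polysOfSmallDiscr 2 Q v).ncard : ℝ) ∧
      ((polysOfSmallDiscr 2 Q v).ncard : ℝ) ≤ 50 * Q ^ (3 - 2 * v) := by
    intro Q hQ hQQ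
    have hQ0 : 0 < Q := by linarith
    obtain ⟨f1, f2, f3⟩ := hQ₀ Q ((le_max_left _ _).trans hQQ)
    have hlogQ : 0 < Real.log Q := Real.log_pos hQ
    rw [Real.norm_of_nonneg hlogQ.le, Real.norm_of_nonneg (by positivity)] at f1
    rw [Real.norm_of_nonneg (by positivity), Real.norm_of_nonneg (by positivity)] at f2
    rw [ncard_polysOfSmallDiscr_two]
    set D := 5 * Q ^ (2 - 2 * v) with hD
    have hD1 : 1 ≤ D := by
      have : 1 ≤ Q ^ (2 - 2 * v) := Real.one_le_rpow hQ.le (by linarith)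
      linarith
    have hQ2 : Q ^ (2 - 2 * v) * Q ^ (2 * v) = Q ^ 2 := by
      rw [← Real.rpow_add hQ0, ← Real.rpow_natCast]; norm_num
    have hDQ : D ≤ Q ^ 2 / 2 := by
      rw [hD, ← hQ2]
      nlinarith [Real.rpow_pos_of_pos hQ0 (2 - 2 * v)]
    have h1 := hmain Q D hQ hD1 hDQ
    have hQD : Q * D = 5 * Q ^ (3 - 2 * v) := by
      rw [hD, show (3 - 2 * v) = 1 + (2 - 2 * v) by ring, Real.rpow_add hQ0, Real.rpow_one]
      ring
    have hD32 : D ^ (3 / 2 : ℝ) = 5 ^ (3 / 2 : ℝ) * Q ^ (3 - 3 * v) := by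
      rw [hD, Real.mul_rpow (by norm_num) (by positivity), ← Real.rpow_mul hQ0.le]
      congr 2
      ring
    have g1 : C * (D ^ (3 / 2 : ℝ) * Real.log Q) ≤ Q ^ (3 - 2 * v) := by
      calc C * (D ^ (3 / 2 : ℝ) * Real.log Q)
          ≤ C * (D ^ (3 / 2 : ℝ) * (1 / (C * 5 ^ (3 / 2 : ℝ)) * Q ^ v)) := by gcongr
        _ = Q ^ (3 - 3 * v) * Q ^ v := by rw [hD32]; field_simp
        _ = _ := by rw [← Real.rpow_add hQ0]; congr 1; ring
    have g2 : C * (Q * Real.log Q) ^ (3 / 2 : ℝ) ≤ Q ^ (3 - 2 * v) := by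
      rw [Real.mul_rpow hQ0.le hlogQ.le]
      calc C * (Q ^ (3 / 2 : ℝ) * Real.log Q ^ (3 / 2 : ℝ))
          ≤ C * (Q ^ (3 / 2 : ℝ) * (1 / C * Q ^ (3 / 2 - 2 * v))) := by gcongr
        _ = Q ^ (3 / 2 : ℝ) * Q ^ (3 / 2 - 2 * v) := by field_simp
        _ = _ := by rw [← Real.rpow_add hQ0]; congr 1; ring
    have hP : 0 < Q ^ (3 - 2 * v) := by positivity
    rw [mul_assoc, hQD, abs_le] at h1
    -- The main term is 20(ln 2 + 1)Q^{3-2v}, with coefficient between 33 and 34, and the errors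
    -- total at most 2Q^{3-2v}.
    constructor <;> nlinarith
  refine ⟨1 / Q₁ ^ (3 - 2 * v), max 50 ((2 * (⌊Q₁⌋₊ : ℝ) + 1) ^ 3), by positivity, by positivity,
    fun Q hQ => ?_⟩
  have hQ0 : 0 < Q := by linarith
  have hP1 : 1 ≤ Q ^ (3 - 2 * v) := Real.one_le_rpow hQ.le (by linarith)
  have hP1' : 1 ≤ Q₁ ^ (3 - 2 * v) := Real.one_le_rpow hQ₁1 (by linarith)
  rcases le_total Q₁ Q with h | h
  · obtain ⟨h1, h2⟩ := hlarge Q hQ h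
    refine ⟨le_trans ?_ h1, h2.trans ?_⟩
    · rw [div_mul_eq_mul_div, one_mul]
      exact div_le_self (by positivity) hP1'
    · gcongr
      exact le_max_left _ _
  -- For Q ≤ Q₁ the polynomial x² is always counted, and the whole box of coefficients bounds the
  -- count above.
  · rw [ncard_polysOfSmallDiscr_two, quadCount_eq_card hQ0.le (by positivity)]
    have hR : 1 ≤ ⌊Q⌋₊ := Nat.le_floor (by simpa using hQ.le)
    have hRR : ⌊Q⌋₊ ≤ ⌊Q₁⌋₊ := Nat.floor_le_floor h
    constructor
    · have h1 : 1 ≤ (quadTriples ⌊Q⌋₊ ⌊5 * Q ^ (2 - 2 * v)⌋₊).card := by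
        rw [Nat.one_le_iff_ne_zero, ← Nat.pos_iff_ne_zero, Finset.card_pos]
        refine ⟨(1, 0, 0), ?_⟩
        simp only [quadTriples, Finset.mem_filter, Finset.mem_product, Finset.mem_Icc]
        exact ⟨⟨by omega, by omega, by omega⟩, one_ne_zero, by simp⟩
      have h1' : (1 : ℝ) ≤ (quadTriples ⌊Q⌋₊ ⌊5 * Q ^ (2 - 2 * v)⌋₊).card := by exact_mod_cast h1
      refine le_trans ?_ h1'
      rw [div_mul_eq_mul_div, one_mul, div_le_one (by positivity)]
      exact Real.rpow_le_rpow hQ0.le h (by linarith)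
    · have h2 : (quadTriples ⌊Q⌋₊ ⌊5 * Q ^ (2 - 2 * v)⌋₊).card ≤ (2 * ⌊Q₁⌋₊ + 1) ^ 3 := by
        refine (Finset.card_filter_le _ _).trans ?_
        have h3 : (Finset.Icc (-⌊Q⌋₊ : ℤ) ⌊Q⌋₊).card = 2 * ⌊Q⌋₊ + 1 := by
          rw [Int.card_Icc]; omega
        rw [Finset.card_product, Finset.card_product, h3]
        calc _ = (2 * ⌊Q⌋₊ + 1) ^ 3 := by ring
          _ ≤ _ := by gcongr
      have h2' : ((quadTriples ⌊Q⌋₊ ⌊5 * Q ^ (2 - 2 * v)⌋₊).card : ℝ) ≤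
          (2 * (⌊Q₁⌋₊ : ℝ) + 1) ^ 3 := by exact_mod_cast h2
      refine (h2'.trans (le_max_right 50 _)).trans ?_
      exact le_mul_of_one_le_right (by positivity) hP1

theorem theorem1 :
    (∃ C : ℝ, 0 < C ∧ ∀ Q D : ℝ, 1 < Q → 1 ≤ D → D ≤ Q ^ 2 / 2 →
      |(quadCount Q D : ℝ) - 4 * (Real.log 2 + 1) * Q * D| ≤
        C * (D ^ (3 / 2 : ℝ) * Real.log Q + (Q * Real.log Q) ^ (3 / 2 : ℝ))) ∧
    (∀ v : ℝ, 0 < v → v < 3 / 4 →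
      ∃ c₁ c₂ : ℝ, 0 < c₁ ∧ 0 < c₂ ∧ ∀ Q : ℝ, 1 < Q →
        c₁ * Q ^ (3 - 2 * v) ≤ ((polysOfSmallDiscr 2 Q v).ncard : ℝ) ∧
        ((polysOfSmallDiscr 2 Q v).ncard : ℝ) ≤ c₂ * Q ^ (3 - 2 * v)) := by
  exact ⟨exists_abs_quadCount_sub_le, fun _ hv hv' => ncard_polysOfSmallDiscr_bounds hv hv'⟩
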